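/- Let $\Phi_t$ be a flow on $\mathbb R^n$ (with a fixed norm $\|\cdot\|$) that is $C^{1,\alpha}$ in $(t,x)$ for some $\alpha\in(0,1]$, i.e. $C^1$ with locally $\alpha$-Hölder derivative. Let $C\subset\mathbb R^n$ be a $k$-cone, $k\ge 1$: a closed set with $lv\in C$ for all $v\in C$, $l\in\mathbb R$, such that $k$ is the maximal dimension of a linear subspace contained in $C$. Write $x\sim y$ if $x-y\in C$ and $x\approx y$ if $x-y\in\operatorname{Int}C$. Assume that $\Phi_t$ is strongly monotone with respect to $C$, i.e. $x\sim y$ implies $\Phi_t(x)\sim\Phi_t(y)$ for $t\ge 0$, and $x\sim y$, $x\ne y$ imply $\Phi_t(x)\approx\Phi_t(y)$ for $t>0$; and that $D_x\Phi_t(C\setminus\{0\})\subset\operatorname{Int}C$ for all $x$ and all $t>0$. Let $O(x)=\{\Phi_t(x):t\ge0\}$ and $\omega(x)=\bigcap_{s\ge 0}\overline{\{\Phi_t(x):t\ge s\}}$, and let $Q$ be the set of points $x$ with $O(x)\neq\{x\}$ such that $O(x)$ contains two distinct points $p\sim q$. Let $D\subset\mathbb R^n$ be open and $\omega$-compact,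 i.e. $O(y)$ is bounded for each $y\in D$ and $\bigcup_{y\in D}\omega(y)$ is bounded. Let $x\in D$. A $k$-exponential separation along $\omega(x)$ associated with $C$ consists of families of subspaces $(E_z)_{z\in\omega(x)}$ of dimension $k$ and $(F_z)_{z\in\omega(x)}$ of dimension $n-k$, continuous in $z$ for the gap metric (the Hausdorff distance of unit spheres), such that for all $z\in\omega(x)$: $\mathbb R^n=E_z\oplus F_z$; $D_z\Phi_tE_z=E_{\Phi_t(z)}$ and $D_z\Phi_tF_z\subset F_{\Phi_t(z)}$ for $t>0$; $E_z\subset\operatorname{Int}C\cup\{0\}$ and $F_z\cap C=\{0\}$; and there are $M>0$ and $0<\gamma<1$, independent of $z$, with $\|D_z\Phi_tw\|\le M\gamma^t\|D_z\Phi_tv\|$ for all $t\ge0$ and unit vectors $w\in F_z$, $v\in E_z$. Given such a separation, put, for $z\in\omega(x)$, $$\lambda_{kz}=\limsup_{t\to+\infty}\frac{\log m(D_z\Phi_t|_{E_z})}{t},\qquad m(D_z\Phi_t|_{E_z})=\inf_{v\in E_z,\ \|v\|=1}\|D_z\Phi_tv\|,$$ and call $z$ regular if this upper limit is a limit, irregular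 otherwise. Then a $k$-exponential separation along $\omega(x)$ associated with $C$ exists, and for every such separation the following holds: if $\lambda_{kz}>0$ for every regular point $z\in\omega(x)$, and there is an irregular point $z\in\omega(x)$ with $\lambda_{kz}\le0$, then $x\in\overline{Q}$. -/

import Mathlib

open Filter Topology
open scoped NNReal

noncomputable section

namespace ConeFlow

variable {V : Type*} [NormedAddCommGroup V] [NormedSpace ℝ V]

/-! ### Cones of rank `k` and the order relation -/

/-- `C` is a `k`-cone: a closed set, stable under multiplication by every real scalar, such that
`k ≥ 1` is the largest dimension of a linear subspace contained in `C`. -/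
structure IsKCone (k : ℕ) (C : Set V) : Prop where
  one_le : 1 ≤ k
  isClosed : IsClosed C
  smul_mem : ∀ v ∈ C, ∀ l : ℝ, l • v ∈ C
  isGreatest : IsGreatest
    {d : ℕ | ∃ W : Submodule ℝ V, (W : Set V) ⊆ C ∧ Module.finrank ℝ W = d} k

/-- `x ∼ y`. -/
def Ordered (C : Set V) (x y : V) : Prop := x - y ∈ C

/-- `x ≈ y`. -/
def StronglyOrdered (C : Set V) (x y : V) : Prop := x - y ∈ interior C

/-! ### The standing assumptions on the flow -/

/-- The flow is strongly monotone with respect to `C`. -/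
structure StronglyMonotone (Φ : Flow ℝ V) (C : Set V) : Prop where
  monotone : ∀ x y : V, Ordered C x y → ∀ t : ℝ, 0 ≤ t → Ordered C (Φ t x) (Φ t y)
  strongly : ∀ x y : V, x ≠ y → Ordered C x y → ∀ t : ℝ, 0 < t →
    StronglyOrdered C (Φ t x) (Φ t y)

/-- The flow is `C^{1,α}` as a map of the pair `(t, x)`: it is `C¹` and its derivative is locally
Hölder continuous with exponent `α`. -/
structure IsC1Alpha (Φ : Flow ℝ V) (α : ℝ≥0) : Prop where
  contDiff : ContDiff ℝ 1 (fun p : ℝ × V => Φ p.1 p.2)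
  holder : ∀ p : ℝ × V, ∃ U ∈ 𝓝 p, ∃ H : ℝ≥0,
    HolderOnWith H α (fderiv ℝ (fun q : ℝ × V => Φ q.1 q.2)) U

/-- The derivative `D_x Φ_t` of the time-`t` map at the point `x`. -/
def spaceDeriv (Φ : Flow ℝ V) (t : ℝ) (x : V) : V →L[ℝ] V := fderiv ℝ (Φ t) x

/-- The flow is `C^{1,α}` for some `α ∈ (0,1]`, it is strongly monotone with respect to the
`k`-cone `C`, and `D_x Φ_t` maps `C \ {0}` into the interior of `C` for `t > 0`.  (The existence
of a `k`-dimensional `W` with `W \ {0} ⊆ interior C` follows: take `W = D_x Φ_1 W₀` with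
`W₀ ⊆ C` of dimension `k`.) -/
structure FWW (Φ : Flow ℝ V) (C : Set V) (k : ℕ) : Prop where
  isKCone : IsKCone k C
  smooth : ∃ α : ℝ≥0, 0 < α ∧ α ≤ 1 ∧ IsC1Alpha Φ α
  stronglyMonotone : StronglyMonotone Φ C
  spaceDeriv_mem : ∀ (x : V) (t : ℝ), 0 < t → ∀ v ∈ C, v ≠ 0 → spaceDeriv Φ t x v ∈ interior C

/-! ### Orbits, limit sets, pseudo-ordered orbits -/

/-- The `ω`-limit set of a point: the intersection over `s` of the closures of
`{Φ_t(x) : t ≥ s}`. -/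
def omega (Φ : Flow ℝ V) (x : V) : Set V := omegaLimit atTop Φ {x}

/-- `D` is `ω`-compact: forward orbits of its points are bounded, and so is the union of the
`ω`-limit sets of its points. -/
def OmegaCompact (Φ : Flow ℝ V) (D : Set V) : Prop :=
  (∀ x ∈ D, Bornology.IsBounded (Φ.forwardOrbit x)) ∧
    Bornology.IsBounded (⋃ x ∈ D, omega Φ x)

/-- An equilibrium is a point whose forward orbit is that point alone. -/
def IsEquilibrium (Φ : Flow ℝ V) (x : V) : Prop := Φ.forwardOrbit x = {x}

/-- `Q`: the points whose orbit is pseudo-ordered, i.e. nontrivial and containing two distinct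
ordered points. -/
def pseudoOrdered (Φ : Flow ℝ V) (C : Set V) : Set V :=
  {x | ¬ IsEquilibrium Φ x ∧
    ∃ p ∈ Φ.forwardOrbit x, ∃ q ∈ Φ.forwardOrbit x, p ≠ q ∧ Ordered C p q}

/-! ### Exponential separation -/

/-- The gap metric on subspaces: the Hausdorff distance of their unit spheres. -/
def gap (L₁ L₂ : Submodule ℝ V) : ℝ :=
  Metric.hausdorffDist {v | v ∈ L₁ ∧ ‖v‖ = 1} {v | v ∈ L₂ ∧ ‖v‖ = 1}

/-- `K × (Y_x)` is a `d`-dimensional continuous bundle: the map `x ↦ Y_x` from `K` to the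
Grassmannian of `d`-dimensional subspaces is continuous for the gap metric.  Values of `Y` outside
`K` are irrelevant. -/
structure IsContinuousBundle (K : Set V) (d : ℕ) (Y : V → Submodule ℝ V) : Prop where
  finrank_eq : ∀ x ∈ K, Module.finrank ℝ (Y x) = d
  continuous : ∀ x ∈ K, Tendsto (fun y => gap (Y y) (Y x)) (𝓝[K] x) (𝓝 0)

/-- `E ⊕ F` is a `k`-exponential separation of the linearized flow along `K` associated
with `C`. -/
structure IsExponentialSeparation (Φ : Flow ℝ V) (C : Set V) (k : ℕ) (K : Set V)
    (E F : V → Submodule ℝ V) : Prop where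
  bundle_E : IsContinuousBundle K k E
  bundle_F : IsContinuousBundle K (Module.finrank ℝ V - k) F
  isCompl : ∀ x ∈ K, IsCompl (E x) (F x)
  map_E : ∀ x ∈ K, ∀ t : ℝ, 0 < t →
    (E x).map (spaceDeriv Φ t x : V →ₗ[ℝ] V) = E (Φ t x)
  map_F : ∀ x ∈ K, ∀ t : ℝ, 0 < t →
    (F x).map (spaceDeriv Φ t x : V →ₗ[ℝ] V) ≤ F (Φ t x)
  separation : ∃ M γ : ℝ, 0 < M ∧ 0 < γ ∧ γ < 1 ∧
    ∀ x ∈ K, ∀ w ∈ F x, ‖w‖ = 1 → ∀ v ∈ E x, ‖v‖ = 1 → ∀ t : ℝ, 0 ≤ t →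
      ‖spaceDeriv Φ t x w‖ ≤ M * γ ^ t * ‖spaceDeriv Φ t x v‖
  E_subset : ∀ x ∈ K, (E x : Set V) ⊆ interior C ∪ {0}
  F_inter : ∀ x ∈ K, (F x : Set V) ∩ C = {0}

/-! ### The `k`-Lyapunov exponent and regular points -/

/-- The infimum norm `m(A|_L)`: the infimum of `‖A v‖` over the unit vectors `v ∈ L`. -/
def infNorm (A : V →L[ℝ] V) (L : Submodule ℝ V) : ℝ :=
  sInf ((fun v => ‖A v‖) '' {v | v ∈ L ∧ ‖v‖ = 1})

/-- The quotient `log m(D_xΦ_t|_{E_x}) / t`, as an extended real number. -/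
def growthRate (Φ : Flow ℝ V) (E : V → Submodule ℝ V) (x : V) (t : ℝ) : EReal :=
  ((Real.log (infNorm (spaceDeriv Φ t x) (E x)) / t : ℝ) : EReal)

/-- The `k`-Lyapunov exponent `λ_{kx}`: the upper limit of the growth rate as `t → +∞`. -/
def lyapunov (Φ : Flow ℝ V) (E : V → Submodule ℝ V) (x : V) : EReal :=
  limsup (growthRate Φ E x) atTop

/-- `x` is regular: the `k`-Lyapunov exponent is a limit. -/
def IsRegular (Φ : Flow ℝ V) (E : V → Submodule ℝ V) (x : V) : Prop :=
  Tendsto (growthRate Φ E x) atTop (𝓝 (lyapunov Φ E x))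

/-- `ω₀(x)`: the regular points of the `ω`-limit set. -/
def regularOmega (Φ : Flow ℝ V) (E : V → Submodule ℝ V) (x : V) : Set V :=
  {z | z ∈ omega Φ x ∧ IsRegular Φ E z}

end ConeFlow

end

open ConeFlow

/-
Over the compact invariant set `ω(x)` the derivative of the time-one map sends the cone uniformly
into its interior. It therefore still preserves the cone after the directions transverse to a
`k`-dimensional subspace have been enlarged by a factor `1 + δ`. Applied along the orbit to a
subspace of vectors that have always been in the cone, this makes the subspace dominate the
transverse directions exponentially, which yields the exponential separation.

Along the separation, `log m(D_zΦ_t|_{E_z})` is a superadditive cocycle. By lower semicontinuity its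
minimal growth rate `β` is realized exactly, as a limit, at some point of `ω(x)`, which is then
regular with exponent `β`. So positive exponents at the regular points alone make `E`, and by
domination all of `C`, uniformly expanding over `ω(x)`.

If `x` is not in the closure of `Q`, then points close to `x` and ordered with it keep close to the
orbit of `x` forever: were the distance to reach a fixed `δ`, recurrence of the orbit of `x` and
strong monotonicity would produce an ordered pair on the orbit of a point near `x`. This stability
contradicts the expansion of `C`.
-/

namespace ConeFlow

variable {V : Type*} [NormedAddCommGroup V]

theorem flow_neg_apply (Φ : Flow ℝ V) (t : ℝ) (z : V) : Φ (-t) (Φ t z) = z := by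
  rw [← Φ.map_add, neg_add_cancel, Φ.map_zero_apply]

theorem flow_apply_neg (Φ : Flow ℝ V) (t : ℝ) (z : V) : Φ t (Φ (-t) z) = z := by
  rw [← Φ.map_add, add_neg_cancel, Φ.map_zero_apply]

theorem iterate_flow_one (Φ : Flow ℝ V) (n : ℕ) (z : V) : (Φ 1)^[n] z = Φ n z := by
  induction n with
  | zero => simp
  | succ n ih => rw [Function.iterate_succ_apply', ih, ← Φ.map_add, Nat.cast_succ, add_comm]

section Stability

variable {Φ : Flow ℝ V} {C : Set V} {x : V}

theorem mem_forwardOrbit (Φ : Flow ℝ V) (x : V) {t : ℝ} (ht : 0 ≤ t) :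
    Φ t x ∈ Φ.forwardOrbit x :=
  ⟨⟨t, ht⟩, rfl⟩

theorem apply_mem_omega {z : V} (hz : z ∈ omega Φ x) (t : ℝ) : Φ t z ∈ omega Φ x :=
  Φ.isInvariant_omegaLimit atTop {x}
    (fun s => tendsto_atTop_add_const_left _ s tendsto_id) t hz

theorem mem_pseudoOrdered {y : V} {s t : ℝ} (hs : 0 ≤ s) (ht : 0 ≤ t) (hne : Φ s y ≠ Φ t y)
    (hord : Ordered C (Φ s y) (Φ t y)) : y ∈ pseudoOrdered Φ C := by
  have hs' := mem_forwardOrbit Φ y hs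
  have ht' := mem_forwardOrbit Φ y ht
  refine ⟨fun heq => hne ?_, _, hs', _, ht', hne, hord⟩
  rw [heq] at hs' ht'
  exact hs'.trans ht'.symm

theorem exists_seq_norm_sub_eq {δ : ℝ} (hδ : 0 < δ)
    (hesc : ∀ ρ > 0, ∃ y, Ordered C y x ∧ ‖y - x‖ < ρ ∧ ∃ t, 0 ≤ t ∧ δ ≤ ‖Φ t y - Φ t x‖) :
    ∃ (y : ℕ → V) (t : ℕ → ℝ), Tendsto y atTop (𝓝 x) ∧
      ∀ n, Ordered C (y n) x ∧ 0 ≤ t n ∧ ‖Φ (t n) (y n) - Φ (t n) x‖ = δ := by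
  have hexact : ∀ n : ℕ, ∃ y t, ‖y - x‖ < 1 / ((n : ℝ) + 1) ∧ Ordered C y x ∧ 0 ≤ t ∧
      ‖Φ t y - Φ t x‖ = δ := fun n => by
    obtain ⟨y, hyC, hy, t, ht, hty⟩ := hesc (min δ (1 / ((n : ℝ) + 1)))
      (lt_min hδ (by positivity))
    have hcont : ContinuousOn (fun s => ‖Φ s y - Φ s x‖) (Set.Icc 0 t) :=
      ((Φ.continuous continuous_id continuous_const).sub
        (Φ.continuous continuous_id continuous_const)).norm.continuousOn
    have h0 : ‖Φ 0 y - Φ 0 x‖ ≤ δ := by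
      rw [Φ.map_zero]
      exact (hy.trans_le (min_le_left _ _)).le
    obtain ⟨s, hs, hsδ⟩ := intermediate_value_Icc ht hcont ⟨h0, hty⟩
    exact ⟨y, s, hy.trans_le (min_le_right _ _), hyC, hs.1, hsδ⟩
  choose y t hy hyt using hexact
  exact ⟨y, t, tendsto_iff_norm_sub_tendsto_zero.2 (squeeze_zero (fun n => norm_nonneg _)
    (fun n => (hy n).le) tendsto_one_div_add_atTop_nhds_zero_nat), hyt⟩

variable [ProperSpace V]

theorem isCompact_closure_forwardOrbit (hb : Bornology.IsBounded (Φ.forwardOrbit x)) :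
    IsCompact (closure (Φ.forwardOrbit x)) :=
  Metric.isCompact_of_isClosed_isBounded isClosed_closure hb.closure

theorem isCompact_omega (hb : Bornology.IsBounded (Φ.forwardOrbit x)) :
    IsCompact (omega Φ x) := by
  refine (isCompact_closure_forwardOrbit hb).of_isClosed_subset (isClosed_omegaLimit _ _ _) ?_
  refine (omegaLimit_subset_closure_image2 atTop Φ {x} (Ici_mem_atTop 0)).trans
    (closure_mono ?_)
  rintro _ ⟨t, ht, _, rfl, rfl⟩
  exact mem_forwardOrbit Φ _ ht

theorem eventually_mem_of_omega_subset (hb : Bornology.IsBounded (Φ.forwardOrbit x)) {U : Set V}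
    (hU : IsOpen U) (hsub : omega Φ x ⊆ U) : ∀ᶠ t in atTop, Φ t x ∈ U := by
  have habs : ∀ᶠ t in atTop, Set.MapsTo (Φ t) {x} (closure (Φ.forwardOrbit x)) := by
    filter_upwards [Ici_mem_atTop (0 : ℝ)] with t ht
    rintro _ rfl
    exact subset_closure (mem_forwardOrbit Φ _ ht)
  filter_upwards [eventually_mapsTo_of_isCompact_absorbing_of_isOpen_of_omegaLimit_subset atTop Φ
    {x} (isCompact_closure_forwardOrbit hb) habs hU hsub] with t ht using ht rfl

theorem StronglyMonotone.exists_ordered_nhds (hmono : StronglyMonotone Φ C) (hC : IsClosed C)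
    {H : Set V} (hH : IsCompact H) {δ : ℝ} (hδ : 0 < δ) :
    ∃ ε > 0, ∀ b ∈ H, ∀ a, Ordered C a b → ‖a - b‖ = δ →
      ∀ q, dist q (Φ 1 b) < ε → Φ 1 a ≠ q ∧ Ordered C (Φ 1 a) q := by
  have hcont : Continuous fun p : V × V => Φ 1 (p.1 + p.2) - Φ 1 p.1 := by
    have := Φ.continuous_toFun 1
    fun_prop
  obtain ⟨ε, hε, hsub⟩ := ((hH.prod ((isCompact_sphere (0 : V) δ).inter_right hC)).image
    hcont).exists_thickening_subset_open
    ((isOpen_interior (s := C)).inter (isOpen_compl_singleton (x := (0 : V)))) (by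
      rintro _ ⟨⟨b, u⟩, ⟨-, hu, huC⟩, rfl⟩
      have hu0 : u ≠ 0 := ne_zero_of_mem_sphere hδ.ne' ⟨u, hu⟩
      have hne : b + u ≠ b := by simpa using hu0
      refine ⟨hmono.strongly (b + u) b hne (by simpa [Ordered] using huC) 1 one_pos, ?_⟩
      exact sub_ne_zero.2 ((Function.LeftInverse.injective (flow_neg_apply Φ 1)).ne hne))
  refine ⟨ε, hε, fun b hb a hab habδ q hq => ?_⟩
  have hmem : Φ 1 a - q ∈ interior C ∩ {0}ᶜ := hsub (Metric.mem_thickening_iff.2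
    ⟨Φ 1 a - Φ 1 b, ⟨(b, a - b), ⟨hb, by simpa using habδ, hab⟩, by simp⟩,
      by rwa [dist_sub_left]⟩)
  exact ⟨sub_ne_zero.1 hmem.2, interior_subset hmem.1⟩

/-- Two times at which the orbit of `x` returns near the same point turn the ordered pair
`Φ_t(y) ∼ Φ_t(x)` at distance `δ` into an ordered pair on the orbit of `y`. -/
theorem StronglyMonotone.mem_closure_pseudoOrdered (hmono : StronglyMonotone Φ C)
    (hC : IsClosed C) (hb : Bornology.IsBounded (Φ.forwardOrbit x)) {δ : ℝ} (hδ : 0 < δ)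
    {y : ℕ → V} {t : ℕ → ℝ} (hlim : Tendsto y atTop (𝓝 x)) (hy : ∀ n, Ordered C (y n) x)
    (ht : ∀ n, 0 ≤ t n) (hyt : ∀ n, ‖Φ (t n) (y n) - Φ (t n) x‖ = δ) :
    x ∈ closure (pseudoOrdered Φ C) := by
  have hH := isCompact_closure_forwardOrbit hb
  obtain ⟨ε, hε, hord⟩ := hmono.exists_ordered_nhds hC hH hδ
  obtain ⟨q, -, φ, hφ, hq⟩ := hH.tendsto_subseq (x := fun n => Φ (1 + t n) x) fun n =>
    subset_closure (mem_forwardOrbit Φ x (by linarith [ht n]))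
  refine mem_closure_iff_nhds.2 fun N hN => ?_
  have hreturn := hq.eventually (Metric.ball_mem_nhds q (ε := ε / 3) (by positivity))
  obtain ⟨m, hm⟩ := hreturn.exists
  have hyφ := hlim.comp hφ.tendsto_atTop
  have hclose : ∀ᶠ n in atTop,
      dist (Φ (1 + t (φ m)) (y (φ n))) (Φ (1 + t (φ m)) x) < ε / 3 :=
    (((Φ.continuous_toFun (1 + t (φ m))).tendsto x).comp hyφ).eventually
      (Metric.ball_mem_nhds _ (by positivity))
  obtain ⟨n, hn, hmn, hnN⟩ := (hreturn.and (hclose.and (hyφ.eventually_mem hN))).exists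
  have hdist : dist (Φ (1 + t (φ m)) (y (φ n))) (Φ 1 (Φ (t (φ n)) x)) < ε := by
    rw [← Φ.map_add]
    have hn' : dist (Φ (1 + t (φ n)) x) q < ε / 3 := hn
    have hm' : dist (Φ (1 + t (φ m)) x) q < ε / 3 := hm
    linarith [dist_triangle_right (Φ (1 + t (φ m)) x) (Φ (1 + t (φ n)) x) q,
      dist_triangle (Φ (1 + t (φ m)) (y (φ n))) (Φ (1 + t (φ m)) x) (Φ (1 + t (φ n)) x)]
  obtain ⟨hne, hC'⟩ := hord _ (subset_closure (mem_forwardOrbit Φ x (ht (φ n)))) _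
    (hmono.monotone _ _ (hy (φ n)) _ (ht (φ n))) (hyt _) _ hdist
  rw [← Φ.map_add] at hne hC'
  exact ⟨y (φ n), hnN, mem_pseudoOrdered (by linarith [ht (φ n)]) (by linarith [ht (φ m)]) hne hC'⟩

theorem StronglyMonotone.exists_forall_norm_sub_lt (hmono : StronglyMonotone Φ C)
    (hC : IsClosed C) (hb : Bornology.IsBounded (Φ.forwardOrbit x))
    (hx : x ∉ closure (pseudoOrdered Φ C)) {δ : ℝ} (hδ : 0 < δ) :
    ∃ ρ > 0, ∀ y, Ordered C y x → ‖y - x‖ < ρ → ∀ t, 0 ≤ t → ‖Φ t y - Φ t x‖ < δ := by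
  by_contra! hesc
  obtain ⟨y, t, hlim, hyt⟩ := exists_seq_norm_sub_eq hδ hesc
  exact hx (hmono.mem_closure_pseudoOrdered hC hb hδ hlim (fun n => (hyt n).1)
    (fun n => (hyt n).2.1) fun n => (hyt n).2.2)

end Stability

/-- The vectors of `C` around which the ball of radius proportional to their norm stays in `C`:
a quantitative form of belonging to the interior of a cone. -/
def deepPart (C : Set V) (ε : ℝ) : Set V :=
  {v | ∀ w, ‖w‖ ≤ ε * ‖v‖ → v + w ∈ C}

theorem deepPart_subset {C : Set V} {ε : ℝ} (hε : 0 ≤ ε) : deepPart C ε ⊆ C := fun v hv => by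
  simpa using hv 0 (by simpa using mul_nonneg hε (norm_nonneg v))

theorem exists_subset_deepPart {C S : Set V} (hS : IsCompact S) (hSC : S ⊆ interior C) :
    ∃ ε > 0, S ⊆ deepPart C ε := by
  obtain ⟨δ, hδ, hδC⟩ := hS.exists_cthickening_subset_open isOpen_interior hSC
  obtain ⟨b, hb, hSb⟩ := hS.isBounded.exists_pos_norm_le
  refine ⟨δ / b, div_pos hδ hb, fun v hv w hw => interior_subset (hδC ?_)⟩
  refine Metric.mem_cthickening_of_dist_le _ v _ _ hv ?_
  calc dist (v + w) v = ‖w‖ := by rw [dist_eq_norm, add_sub_cancel_left]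
    _ ≤ δ / b * ‖v‖ := hw
    _ ≤ δ / b * b := by gcongr; exact hSb v hv
    _ = δ := div_mul_cancel₀ _ hb.ne'

variable [NormedSpace ℝ V]

section Subspaces

variable [FiniteDimensional ℝ V]

variable (V) in
theorem exists_bounded_projection :
    ∃ c : ℝ, 0 < c ∧ ∀ E : Submodule ℝ V, ∃ π : V →L[ℝ] V, LinearMap.IsProj E π ∧ ‖π‖ ≤ c := by
  let T := toEuclidean (E := V)
  let S : EuclideanSpace ℝ (Fin (Module.finrank ℝ V)) →L[ℝ] V := T.symm
  let T' : V →L[ℝ] EuclideanSpace ℝ (Fin (Module.finrank ℝ V)) := T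
  refine ⟨‖S‖ * (1 * ‖T'‖) + 1, by positivity, fun E => ?_⟩
  let E' := E.map T.toLinearEquiv.toLinearMap
  refine ⟨S ∘L E'.starProjection ∘L T', ⟨fun v => ?_, fun v hv => ?_⟩, ?_⟩
  · obtain ⟨p, hp, hpv⟩ := Submodule.mem_map.1 (E'.starProjection_apply_mem (T v))
    have hp' : T.symm (E'.starProjection (T v)) = p := by
      rw [← hpv]
      exact T.symm_apply_apply p
    change T.symm (E'.starProjection (T v)) ∈ E
    rwa [hp']
  · have hTv : E'.starProjection (T v) = T v :=
      Submodule.starProjection_eq_self_iff.2 (Submodule.mem_map_of_mem hv)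
    change T.symm (E'.starProjection (T v)) = v
    rw [hTv, T.symm_apply_apply]
  · have hle : ‖S ∘L E'.starProjection ∘L T'‖ ≤ ‖S‖ * (1 * ‖T'‖) := by
      refine (S.opNorm_comp_le _).trans ?_
      gcongr
      refine (E'.starProjection.opNorm_comp_le _).trans ?_
      gcongr
      exact E'.starProjection_norm_le
    linarith

/-- Sequential compactness of the Grassmannian, in terms of limits of vectors. -/
theorem exists_subseq_tendsto_submodule {d : ℕ} (P : ℕ → Submodule ℝ V)
    (hP : ∀ j, Module.finrank ℝ (P j) = d) :
    ∃ Q : Submodule ℝ V, Module.finrank ℝ Q = d ∧ ∃ φ : ℕ → ℕ, StrictMono φ ∧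
      ∀ q ∈ Q, ∃ p : ℕ → V, (∀ j, p j ∈ P (φ j)) ∧ Tendsto p atTop (𝓝 q) := by
  obtain ⟨c, -, hc⟩ := exists_bounded_projection V
  choose π hπ hπc using fun j => hc (P j)
  obtain ⟨ρ, -, φ, hφ, hρ⟩ := tendsto_subseq_of_bounded
    (Metric.isBounded_closedBall (x := (0 : V →L[ℝ] V)) (r := c)) (x := π)
    fun j => mem_closedBall_zero_iff.2 (hπc j)
  have hρv : ∀ v, Tendsto (fun j => π (φ j) v) atTop (𝓝 (ρ v)) := fun v =>
    ((ContinuousLinearMap.apply ℝ V v).continuous.tendsto ρ).comp hρ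
  have hidem : IsIdempotentElem (ρ : V →ₗ[ℝ] V) := by
    refine LinearMap.ext fun v => ?_
    have h : Tendsto (fun j => π (φ j) (π (φ j) v)) atTop (𝓝 (ρ (ρ v))) :=
      (isBoundedBilinearMap_apply.continuous.tendsto (ρ, ρ v)).comp (hρ.prodMk_nhds (hρv v))
    refine tendsto_nhds_unique h ((hρv v).congr fun j => ?_)
    exact ((hπ (φ j)).map_id _ ((hπ (φ j)).map_mem v)).symm
  have hproj := LinearMap.IsIdempotentElem.isProj_range _ hidem
  refine ⟨LinearMap.range (ρ : V →ₗ[ℝ] V), ?_, φ, hφ,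
    fun q hq => ⟨fun j => π (φ j) q, fun j => (hπ _).map_mem q, ?_⟩⟩
  · have htr : Continuous fun A : V →L[ℝ] V => LinearMap.trace ℝ V A :=
      (LinearMap.trace ℝ V ∘ₗ ContinuousLinearMap.coeLM ℝ).continuous_of_finiteDimensional
    have hlim := (htr.tendsto ρ).comp hρ
    have hconst : ∀ j, LinearMap.trace ℝ V (π (φ j)) = d := fun j => by
      have hj : LinearMap.IsProj (P (φ j)) (π (φ j) : V →ₗ[ℝ] V) :=
        ⟨(hπ (φ j)).map_mem, (hπ (φ j)).map_id⟩
      rw [hj.trace, hP]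
    have := tendsto_nhds_unique hlim (tendsto_const_nhds.congr fun j => (hconst j).symm)
    rw [hproj.trace] at this
    exact_mod_cast this
  · have hq' : ρ q = q := hproj.map_id q hq
    simpa only [hq'] using hρv q

end Subspaces

theorem exists_smul_norm_add_ge (u : V) {v : V} (hv : v ≠ 0) {a : ℝ} (ha : 0 ≤ a) :
    ∃ s : ℝ, |s| * ‖v‖ ≤ 2 * a ∧ a ≤ ‖u + s • v‖ := by
  have hv' : 0 < ‖v‖ := norm_pos_iff.2 hv
  by_cases hu : a ≤ ‖u‖
  · exact ⟨0, by simpa using ha, by simpa using hu⟩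
  refine ⟨2 * a / ‖v‖, (by rw [abs_of_nonneg (by positivity), div_mul_cancel₀ _ hv'.ne']), ?_⟩
  have hs : ‖(2 * a / ‖v‖) • v‖ = 2 * a := by
    rw [norm_smul, Real.norm_of_nonneg (by positivity), div_mul_cancel₀ _ hv'.ne']
  have := norm_sub_le (u + (2 * a / ‖v‖) • v) u
  rw [add_sub_cancel_left, hs] at this
  linarith [not_le.1 hu]

namespace IsKCone

variable {C : Set V} {k : ℕ}

theorem zero_mem (hC : IsKCone k C) : (0 : V) ∈ C := by
  obtain ⟨W, hW, -⟩ := hC.isGreatest.1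
  exact hW W.zero_mem

variable [FiniteDimensional ℝ V]

theorem mem_of_forall_add_mem (hC : IsKCone k C) {E : Submodule ℝ V}
    (hEk : Module.finrank ℝ E = k) (hEC : (E : Set V) ⊆ C) {w : V} (hw : ∀ u ∈ E, u + w ∈ C) :
    w ∈ E := by
  by_contra hwE
  have hsub : ((E ⊔ Submodule.span ℝ {w} : Submodule ℝ V) : Set V) ⊆ C := by
    intro p hp
    obtain ⟨u, hu, q, hq, rfl⟩ := Submodule.mem_sup.1 hp
    obtain ⟨t, rfl⟩ := Submodule.mem_span_singleton.1 hq
    by_cases ht : t = 0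
    · simpa [ht] using hEC hu
    · have := hC.smul_mem _ (hw _ (E.smul_mem t⁻¹ hu)) t
      rwa [smul_add, smul_inv_smul₀ ht] at this
  have hle := hC.isGreatest.2 ⟨_, hsub, Submodule.finrank_sup_span_singleton hwE⟩
  omega

theorem exists_far_vector (hC : IsKCone k C) :
    ∃ ε > 0, ∀ P : Submodule ℝ V, Module.finrank ℝ P = k + 1 →
      ∃ p ∈ P, ∀ c ∈ C, ε * ‖p‖ < ‖p - c‖ := by
  by_contra! hcon
  choose P hP hPC using fun j : ℕ => hcon (1 / ((j : ℝ) + 1)) (by positivity)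
  obtain ⟨Q, hQ, φ, hφ, hlim⟩ := exists_subseq_tendsto_submodule P hP
  have hQC : (Q : Set V) ⊆ C := by
    intro q hq
    obtain ⟨p, hpP, hpq⟩ := hlim q hq
    choose c hcC hc using fun j => hPC (φ j) (p j) (hpP j)
    have hdist : Tendsto (fun j => 1 / ((φ j : ℝ) + 1) * ‖p j‖) atTop (𝓝 0) := by
      simpa using
        ((tendsto_one_div_add_atTop_nhds_zero_nat (𝕜 := ℝ)).comp hφ.tendsto_atTop).mul hpq.norm
    have hcq : Tendsto c atTop (𝓝 q) := by
      simpa using hpq.sub (squeeze_zero_norm hc hdist)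
    exact hC.isClosed.mem_of_tendsto hcq (Eventually.of_forall hcC)
  have hle := hC.isGreatest.2 ⟨Q, hQC, hQ⟩
  omega

theorem exists_far_translate (hC : IsKCone k C) :
    ∃ ε > 0, ∀ E : Submodule ℝ V, Module.finrank ℝ E = k → (E : Set V) ⊆ C →
      ∀ w, ∃ e ∈ E, ∀ c ∈ C, ε * ‖w - e‖ ≤ ‖w - e - c‖ := by
  obtain ⟨ε, hε, hfar⟩ := hC.exists_far_vector
  refine ⟨ε, hε, fun E hE hEC w => ?_⟩
  by_cases hw : w ∈ E
  · exact ⟨w, hw, by simp⟩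
  obtain ⟨p, hp, hpC⟩ := hfar _ (by rw [Submodule.finrank_sup_span_singleton hw, hE])
  obtain ⟨u, hu, q, hq, rfl⟩ := Submodule.mem_sup.1 hp
  obtain ⟨t, rfl⟩ := Submodule.mem_span_singleton.1 hq
  have ht : t ≠ 0 := by
    rintro rfl
    have := hpC _ (hEC hu)
    rw [zero_smul, add_zero, sub_self, norm_zero] at this
    exact this.not_ge (by positivity)
  refine ⟨-(t⁻¹ • u), E.neg_mem (E.smul_mem _ hu), fun c hc => ?_⟩
  have hp_eq : u + t • w = t • (w - -(t⁻¹ • u)) := by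
    rw [smul_sub, smul_neg, smul_inv_smul₀ ht]
    abel
  have hlt := hpC _ (hC.smul_mem c hc t)
  rw [hp_eq, ← smul_sub, norm_smul, norm_smul, mul_left_comm] at hlt
  exact (lt_of_mul_lt_mul_left hlt (norm_nonneg t)).le

/-- The image of a deep `k`-dimensional subspace of the cone dominates the rest of the image, with
a constant independent of the map: otherwise the image of the cone would come too close to a
subspace of dimension `k + 1`. -/
theorem exists_domination (hC : IsKCone k C) {ε : ℝ} (hε : 0 < ε) :
    ∃ R > 0, ∀ (L : V →L[ℝ] V) (E : Submodule ℝ V),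
      Module.finrank ℝ (E.map (L : V →ₗ[ℝ] V)) = k → Set.MapsTo L C C →
      (E : Set V) ⊆ deepPart C ε →
      ∀ v ∈ E, ∀ w, ∃ e ∈ E, ‖v‖ * ‖L w - L e‖ ≤ R * ‖L v‖ * ‖w‖ := by
  obtain ⟨δ, hδ, hfar⟩ := hC.exists_far_translate
  refine ⟨2 / (ε * δ), by positivity, fun L E hLE hLC hE v hv w => ?_⟩
  by_cases hv0 : v = 0
  · exact ⟨0, E.zero_mem, by simp [hv0]⟩
  have hmapC : (E.map (L : V →ₗ[ℝ] V) : Set V) ⊆ C := by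
    rintro _ ⟨u, hu, rfl⟩
    exact hLC (deepPart_subset hε.le (hE hu))
  obtain ⟨_, ⟨e, he, rfl⟩, hfar_e⟩ := hfar _ hLE hmapC (L w)
  rw [ContinuousLinearMap.coe_coe] at hfar_e
  obtain ⟨s, hs, hsw⟩ := exists_smul_norm_add_ge (-e) hv0 (a := ‖w‖ / ε) (by positivity)
  have hmem : L (-e + s • v + w) ∈ C := by
    refine hLC (hE (E.add_mem (E.neg_mem he) (E.smul_mem s hv)) w ?_)
    rwa [div_le_iff₀' hε] at hsw
  have hdist : δ * ‖L w - L e‖ ≤ |s| * ‖L v‖ := by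
    have hdiff : L w - L e - L (-e + s • v + w) = -(s • L v) := by
      simp only [map_add, map_neg, map_smul]
      abel
    simpa only [hdiff, norm_neg, norm_smul, Real.norm_eq_abs] using hfar_e _ hmem
  refine ⟨e, he, ?_⟩
  calc ‖v‖ * ‖L w - L e‖ = ‖v‖ * (δ * ‖L w - L e‖) / δ := by field_simp
    _ ≤ ‖v‖ * (|s| * ‖L v‖) / δ := by gcongr
    _ = |s| * ‖v‖ * ‖L v‖ / δ := by ring
    _ ≤ 2 * (‖w‖ / ε) * ‖L v‖ / δ := by gcongr
    _ = 2 / (ε * δ) * ‖L v‖ * ‖w‖ := by field_simp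

end IsKCone

section Bundles

/-- The unit sphere of a subspace, on which `gap` and `infNorm` are computed. -/
def unitVectors (L : Submodule ℝ V) : Set V := {v | v ∈ L ∧ ‖v‖ = 1}

theorem normalize_mem_unitVectors {L : Submodule ℝ V} {v : V} (hv : v ∈ L) (hv0 : v ≠ 0) :
    NormedSpace.normalize v ∈ unitVectors L :=
  ⟨L.smul_mem _ hv, NormedSpace.norm_normalize hv0⟩

theorem unitVectors_nonempty {L : Submodule ℝ V} (hL : L ≠ ⊥) : (unitVectors L).Nonempty := by
  obtain ⟨v, hv, hv0⟩ := Submodule.exists_mem_ne_zero_of_ne_bot hL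
  exact ⟨_, normalize_mem_unitVectors hv hv0⟩

theorem tendsto_normalize {v : ℕ → V} {v₀ : V} (hv : Tendsto v atTop (𝓝 v₀)) (hv₀ : v₀ ≠ 0) :
    Tendsto (fun j => NormedSpace.normalize (v j)) atTop (𝓝 (NormedSpace.normalize v₀)) :=
  (hv.norm.inv₀ (norm_ne_zero_iff.2 hv₀)).smul hv

/-- The graph of `Y` over `K` is sequentially closed.  For families of subspaces of constant
dimension this is continuity in the gap metric, in a form that can be tested vector by vector. -/
def HasClosedGraph (K : Set V) (Y : V → Submodule ℝ V) : Prop :=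
  ∀ (z : ℕ → V) (z₀ : V), (∀ j, z j ∈ K) → z₀ ∈ K → Tendsto z atTop (𝓝 z₀) →
    ∀ (v : ℕ → V) (v₀ : V), (∀ j, v j ∈ Y (z j)) → Tendsto v atTop (𝓝 v₀) → v₀ ∈ Y z₀

variable [FiniteDimensional ℝ V]

theorem isCompact_unitVectors (L : Submodule ℝ V) : IsCompact (unitVectors L) := by
  have hinter : unitVectors L = (L : Set V) ∩ Metric.sphere 0 1 := by
    ext v
    simp [unitVectors]
  exact hinter ▸ (isCompact_sphere 0 1).inter_left L.closed_of_finiteDimensional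

variable {K : Set V} {d : ℕ} {Y : V → Submodule ℝ V}

theorem HasClosedGraph.upperSemicontinuous_unitVectors (hY : HasClosedGraph K Y) {x : V}
    (hx : x ∈ K) {ε : ℝ} (hε : 0 < ε) :
    ∀ᶠ y in 𝓝[K] x, ∀ v ∈ unitVectors (Y y), ∃ w ∈ unitVectors (Y x), dist v w ≤ ε := by
  by_contra hcon
  obtain ⟨z, hz, hbad⟩ := exists_seq_forall_of_frequently
    ((not_eventually.1 hcon).and_eventually self_mem_nhdsWithin)
  rw [forall_and] at hbad
  obtain ⟨hbad, hzK⟩ := hbad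
  push Not at hbad
  choose v hv hvfar using hbad
  obtain ⟨w, hw, φ, hφ, hlim⟩ := (isCompact_sphere (0 : V) 1).tendsto_subseq
    (x := v) (fun j => by simpa using (hv j).2)
  have hwY : w ∈ Y x := hY (z ∘ φ) x (fun j => hzK _) hx
    ((tendsto_nhds_of_tendsto_nhdsWithin hz).comp hφ.tendsto_atTop) _ w (fun j => (hv _).1) hlim
  obtain ⟨j, hj⟩ := (hlim.eventually (Metric.ball_mem_nhds w hε)).exists
  exact lt_asymm (hvfar (φ j) w ⟨hwY, by simpa using hw⟩) hj

theorem HasClosedGraph.exists_subseq_tendsto (hY : HasClosedGraph K Y)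
    (hd : ∀ z ∈ K, Module.finrank ℝ (Y z) = d) {z : ℕ → V} {x : V} (hzK : ∀ j, z j ∈ K)
    (hx : x ∈ K) (hz : Tendsto z atTop (𝓝 x)) {w : V} (hw : w ∈ Y x) :
    ∃ φ : ℕ → ℕ, StrictMono φ ∧ ∃ p : ℕ → V, (∀ j, p j ∈ Y (z (φ j))) ∧ Tendsto p atTop (𝓝 w) := by
  obtain ⟨Q, hQ, φ, hφ, hlim⟩ := exists_subseq_tendsto_submodule (fun j => Y (z j))
    (fun j => hd _ (hzK j))
  have hle : Q ≤ Y x := fun q hq => by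
    obtain ⟨p, hp, hpq⟩ := hlim q hq
    exact hY (z ∘ φ) x (fun j => hzK _) hx (hz.comp hφ.tendsto_atTop) p q hp hpq
  rw [← Submodule.eq_of_le_of_finrank_eq hle (hQ.trans (hd x hx).symm)] at hw
  exact ⟨φ, hφ, hlim w hw⟩

theorem HasClosedGraph.lowerSemicontinuous_unitVectors (hY : HasClosedGraph K Y)
    (hd : ∀ z ∈ K, Module.finrank ℝ (Y z) = d) {x : V} (hx : x ∈ K) {ε : ℝ} (hε : 0 < ε) :
    ∀ᶠ y in 𝓝[K] x, ∀ w ∈ unitVectors (Y x), ∃ v ∈ unitVectors (Y y), dist w v ≤ ε := by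
  by_contra hcon
  obtain ⟨z, hz, hbad⟩ := exists_seq_forall_of_frequently
    ((not_eventually.1 hcon).and_eventually self_mem_nhdsWithin)
  rw [forall_and] at hbad
  obtain ⟨hbad, hzK⟩ := hbad
  push Not at hbad
  choose w hw hwfar using hbad
  obtain ⟨w₀, ⟨hw₀, hw₀1⟩, φ, hφ, hlim⟩ := (isCompact_unitVectors (Y x)).tendsto_subseq hw
  have hw₀0 : w₀ ≠ 0 := norm_ne_zero_iff.1 (hw₀1.trans_ne one_ne_zero)
  obtain ⟨ψ, hψ, p, hp, hpw⟩ := hY.exists_subseq_tendsto hd (fun j => hzK (φ j)) hx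
    ((tendsto_nhds_of_tendsto_nhdsWithin hz).comp hφ.tendsto_atTop) hw₀
  have hdist : Tendsto (fun j => dist (w (φ (ψ j))) (NormedSpace.normalize (p j)))
      atTop (𝓝 0) := by
    have := (hlim.comp hψ.tendsto_atTop).dist (tendsto_normalize hpw hw₀0)
    rwa [NormedSpace.normalize_eq_self_of_norm_eq_one hw₀1, dist_self] at this
  obtain ⟨j, hj, hj0⟩ :=
    ((hdist.eventually (gt_mem_nhds hε)).and (hpw.eventually_ne hw₀0)).exists
  exact lt_asymm (hwfar (φ (ψ j)) _ (normalize_mem_unitVectors (hp j) hj0)) hj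

theorem HasClosedGraph.isContinuousBundle (hY : HasClosedGraph K Y)
    (hd : ∀ z ∈ K, Module.finrank ℝ (Y z) = d) : IsContinuousBundle K d Y := by
  refine ⟨hd, fun x hx => Metric.tendsto_nhds.2 fun ε hε => ?_⟩
  filter_upwards [hY.upperSemicontinuous_unitVectors hx (half_pos hε),
    hY.lowerSemicontinuous_unitVectors hd hx (half_pos hε)] with y hy hy'
  rw [Real.dist_0_eq_abs, gap, abs_of_nonneg Metric.hausdorffDist_nonneg]
  exact (Metric.hausdorffDist_le_of_mem_dist (half_pos hε).le hy hy').trans_lt (half_lt_self hε)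

theorem IsContinuousBundle.hasClosedGraph (hY : IsContinuousBundle K d Y) :
    HasClosedGraph K Y := by
  intro z z₀ hz hz₀ hlim v v₀ hv hvlim
  by_cases hv0 : v₀ = 0
  · exact hv0 ▸ (Y z₀).zero_mem
  have hne : ∀ᶠ j in atTop, v j ≠ 0 := hvlim.eventually_ne hv0
  have hbot : Y z₀ ≠ ⊥ := by
    obtain ⟨j, hj⟩ := hne.exists
    rw [← Submodule.one_le_finrank_iff, hY.finrank_eq _ hz₀, ← hY.finrank_eq _ (hz j),
      Submodule.one_le_finrank_iff]
    exact (Submodule.ne_bot_iff _).2 ⟨v j, hv j, hj⟩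
  have hgap : Tendsto (fun j => gap (Y (z j)) (Y z₀)) atTop (𝓝 0) :=
    (hY.continuous z₀ hz₀).comp (tendsto_nhdsWithin_iff.2 ⟨hlim, Eventually.of_forall hz⟩)
  have hinf : Tendsto (fun j => Metric.infDist (NormedSpace.normalize (v j)) (unitVectors (Y z₀)))
      atTop (𝓝 0) := by
    refine squeeze_zero' (Eventually.of_forall fun j => Metric.infDist_nonneg) ?_ hgap
    filter_upwards [hne] with j hj
    have hmem := normalize_mem_unitVectors (hv j) hj
    exact Metric.infDist_le_hausdorffDist_of_mem hmem
      (Metric.hausdorffEDist_ne_top_of_nonempty_of_bounded ⟨_, hmem⟩ (unitVectors_nonempty hbot)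
        (isCompact_unitVectors _).isBounded (isCompact_unitVectors _).isBounded)
  have hzero : Metric.infDist (NormedSpace.normalize v₀) (unitVectors (Y z₀)) = 0 :=
    tendsto_nhds_unique (((Metric.continuous_infDist_pt _).tendsto _).comp
      (tendsto_normalize hvlim hv0)) hinf
  have hmem := ((isCompact_unitVectors (Y z₀)).isClosed.mem_iff_infDist_zero
    (unitVectors_nonempty hbot)).2 hzero
  exact ((Y z₀).smul_mem_iff (inv_ne_zero (norm_ne_zero_iff.2 hv0))).1 hmem.1

end Bundles

theorem IsKCone.smul_mem_deepPart {C : Set V} {k : ℕ} (hC : IsKCone k C) {ε : ℝ} {v : V}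
    (hv : v ∈ deepPart C ε) (l : ℝ) : l • v ∈ deepPart C ε := by
  intro w hw
  by_cases hl : l = 0
  · have hw0 : w = 0 := by simpa [hl] using hw
    simpa [hl, hw0] using hC.zero_mem
  have hw' : ‖l⁻¹ • w‖ ≤ ε * ‖v‖ := by
    rw [norm_smul, norm_inv, inv_mul_le_iff₀ (norm_pos_iff.2 hl)]
    rwa [norm_smul, mul_left_comm] at hw
  simpa [smul_inv_smul₀ hl] using hC.smul_mem _ (hv _ hw') l

section Flow

theorem spaceDeriv_zero_apply (Φ : Flow ℝ V) (z v : V) : spaceDeriv Φ 0 z v = v := by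
  simp [spaceDeriv, Φ.map_zero]

variable {Φ : Flow ℝ V} (h : ContDiff ℝ 1 fun p : ℝ × V => Φ p.1 p.2)
include h

theorem hasStrictFDerivAt_flow (t : ℝ) (z : V) : HasStrictFDerivAt (Φ t) (spaceDeriv Φ t z) z :=
  (h.comp (contDiff_const.prodMk contDiff_id)).contDiffAt.hasStrictFDerivAt one_ne_zero

theorem continuous_spaceDeriv : Continuous fun p : ℝ × V => spaceDeriv Φ p.1 p.2 := by
  have hpartial : (fun p : ℝ × V => spaceDeriv Φ p.1 p.2) = fun p : ℝ × V =>
      (fderiv ℝ (fun q : ℝ × V => Φ q.1 q.2) p).comp (ContinuousLinearMap.inr ℝ ℝ V) := by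
    ext1 p
    have hp : HasFDerivAt (fun q : ℝ × V => Φ q.1 q.2) _ (p.1, p.2) :=
      (h.differentiable one_ne_zero p).hasFDerivAt
    exact (hp.comp p.2 (hasFDerivAt_prodMk_right p.1 p.2)).fderiv
  rw [hpartial]
  exact (h.continuous_fderiv one_ne_zero).clm_comp continuous_const

theorem spaceDeriv_add_apply (s t : ℝ) (z v : V) :
    spaceDeriv Φ (s + t) z v = spaceDeriv Φ s (Φ t z) (spaceDeriv Φ t z v) := by
  have hcomp : (Φ s ∘ Φ t : V → V) = Φ (s + t) := funext fun y => (Φ.map_add s t y).symm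
  have hchain := (hasStrictFDerivAt_flow h s (Φ t z)).hasFDerivAt.comp z
    (hasStrictFDerivAt_flow h t z).hasFDerivAt
  rw [hcomp] at hchain
  exact congrArg (· v) hchain.fderiv

theorem spaceDeriv_neg_apply (t : ℝ) (z v : V) :
    spaceDeriv Φ (-t) (Φ t z) (spaceDeriv Φ t z v) = v := by
  rw [← spaceDeriv_add_apply h, neg_add_cancel, spaceDeriv_zero_apply]

theorem spaceDeriv_apply_neg (t : ℝ) (z v : V) :
    spaceDeriv Φ t (Φ (-t) z) (spaceDeriv Φ (-t) z v) = v := by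
  simpa using spaceDeriv_neg_apply h (-t) z v

theorem spaceDeriv_injective (t : ℝ) (z : V) : Function.Injective (spaceDeriv Φ t z) :=
  Function.LeftInverse.injective (spaceDeriv_neg_apply h t z)

theorem finrank_map_spaceDeriv (t : ℝ) (z : V) (E : Submodule ℝ V) :
    Module.finrank ℝ (E.map (spaceDeriv Φ t z : V →ₗ[ℝ] V)) = Module.finrank ℝ E :=
  (E.equivMapOfInjective _ (spaceDeriv_injective h t z)).finrank_eq.symm

theorem exists_norm_spaceDeriv_le {K : Set V} (hK : IsCompact K) (T : ℝ) :
    ∃ M : ℝ, 1 ≤ M ∧ ∀ z ∈ K, ∀ t, |t| ≤ T → ∀ v, ‖spaceDeriv Φ t z v‖ ≤ M * ‖v‖ := by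
  obtain ⟨M, hM⟩ := (isCompact_Icc (a := -T) (b := T)).prod hK |>.exists_bound_of_continuousOn
    (continuous_spaceDeriv h).continuousOn
  refine ⟨max M 1, le_max_right _ _, fun z hz t ht v => ?_⟩
  exact (spaceDeriv Φ t z).le_of_opNorm_le ((hM (t, z) ⟨abs_le.1 ht, hz⟩).trans (le_max_left _ _)) v

end Flow

/-- Over the compact invariant set `K` the linearized flow preserves the cone, pushes it inwards
after time one by the relative amount `ε`, and has norm at most `M` over times in `[-1, 1]`. -/
structure UniformlyPositive (Φ : Flow ℝ V) (C : Set V) (k : ℕ) (K : Set V) (ε M : ℝ) : Prop where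
  isKCone : IsKCone k C
  contDiff : ContDiff ℝ 1 fun p : ℝ × V => Φ p.1 p.2
  isCompact : IsCompact K
  invariant : ∀ z ∈ K, ∀ t, Φ t z ∈ K
  mem_cone : ∀ z t, 0 ≤ t → ∀ v ∈ C, spaceDeriv Φ t z v ∈ C
  eps_pos : 0 < ε
  one_le : 1 ≤ M
  mem_deepPart : ∀ z ∈ K, ∀ v ∈ C, spaceDeriv Φ 1 z v ∈ deepPart C ε
  norm_le : ∀ z ∈ K, ∀ t, |t| ≤ 1 → ∀ v, ‖spaceDeriv Φ t z v‖ ≤ M * ‖v‖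

theorem exists_uniformlyPositive [FiniteDimensional ℝ V] {Φ : Flow ℝ V} {C : Set V} {k : ℕ}
    (hC : IsKCone k C) (h : ContDiff ℝ 1 fun p : ℝ × V => Φ p.1 p.2)
    (hpos : ∀ x t, 0 < t → ∀ v ∈ C, v ≠ 0 → spaceDeriv Φ t x v ∈ interior C)
    {K : Set V} (hK : IsCompact K) (hinv : ∀ z ∈ K, ∀ t, Φ t z ∈ K) :
    ∃ ε M : ℝ, UniformlyPositive Φ C k K ε M := by
  obtain ⟨M, hM1, hM⟩ := exists_norm_spaceDeriv_le h hK 1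
  have hcont : Continuous fun p : V × V => spaceDeriv Φ 1 p.1 p.2 :=
    ((continuous_spaceDeriv h).comp (continuous_const.prodMk continuous_fst)).clm_apply
      continuous_snd
  have hS : IsCompact (K ×ˢ (Metric.sphere (0 : V) 1 ∩ C)) :=
    hK.prod ((isCompact_sphere 0 1).inter_right hC.isClosed)
  obtain ⟨ε, hε, hεC⟩ := exists_subset_deepPart (C := C) (hS.image hcont) (by
    rintro _ ⟨⟨z, v⟩, ⟨-, hv, hvC⟩, rfl⟩
    exact hpos z 1 one_pos v hvC (Metric.ne_of_mem_sphere hv one_ne_zero))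
  refine ⟨ε, M, hC, h, hK, hinv, fun z t ht v hv => ?_, hε, hM1, fun z hz v hv => ?_, hM⟩
  · rcases ht.eq_or_lt with rfl | ht
    · rwa [spaceDeriv_zero_apply]
    by_cases hv0 : v = 0
    · rw [hv0, map_zero]
      exact hC.zero_mem
    · exact interior_subset (hpos z t ht v hv hv0)
  · by_cases hv0 : v = 0
    · rw [hv0, map_zero]
      simpa [deepPart] using hC.zero_mem
    have hunit : NormedSpace.normalize v ∈ Metric.sphere (0 : V) 1 ∩ C :=
      ⟨by simpa using NormedSpace.norm_normalize hv0, hC.smul_mem v hv _⟩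
    have hdeep : spaceDeriv Φ 1 z (NormedSpace.normalize v) ∈ deepPart C ε :=
      hεC ⟨(z, NormedSpace.normalize v), ⟨hz, hunit⟩, rfl⟩
    have := hC.smul_mem_deepPart hdeep ‖v‖
    rwa [← map_smul, NormedSpace.norm_smul_normalize] at this

/-- The vectors at `z` whose backward orbit under the linearized flow stays in the cone; over an
exponential separation this is the bundle `E`. -/
def coneCore (Φ : Flow ℝ V) (C : Set V) (z : V) : Set V :=
  {v | ∀ n : ℕ, spaceDeriv Φ (-n) z v ∈ C}

theorem coneCore_subset_cone (Φ : Flow ℝ V) (C : Set V) (z : V) : coneCore Φ C z ⊆ C :=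
  fun v hv => by simpa [spaceDeriv_zero_apply] using hv 0

theorem exists_inward_perturbation [FiniteDimensional ℝ V] (C : Set V) {ε : ℝ} (hε : 0 < ε) :
    ∃ δ : ℝ, 0 < δ ∧ ∀ (A : V →L[ℝ] V) (P : Submodule ℝ V), Set.MapsTo A C (deepPart C ε) →
      ∃ L : V →L[ℝ] V, Set.MapsTo L C C ∧ (∀ v, A v ∈ P → L v = A v) ∧
        ∀ v, L v - (1 + δ) • A v ∈ P := by
  obtain ⟨c, hc, hproj⟩ := exists_bounded_projection V
  refine ⟨ε / (1 + c), by positivity, fun A P hA => ?_⟩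
  obtain ⟨π, hπ, hπc⟩ := hproj P
  refine ⟨A + (ε / (1 + c)) • (A - π ∘L A), fun v hv => hA hv _ ?_, fun v hv => ?_, fun v => ?_⟩
  · change ‖(ε / (1 + c)) • (A v - π (A v))‖ ≤ ε * ‖A v‖
    have hdist : ‖A v - π (A v)‖ ≤ (1 + c) * ‖A v‖ := by
      linarith [norm_sub_le (A v) (π (A v)), π.le_of_opNorm_le hπc (A v)]
    rw [norm_smul, Real.norm_of_nonneg (by positivity), div_mul_eq_mul_div,
      div_le_iff₀ (by positivity), mul_assoc, mul_comm ‖A v‖]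
    gcongr
  · simp [hπ.map_id _ hv]
  · have hv : (A + (ε / (1 + c)) • (A - π ∘L A)) v - (1 + ε / (1 + c)) • A v =
        -((ε / (1 + c)) • π (A v)) := by
      simp only [add_apply, smul_apply, sub_apply, ContinuousLinearMap.comp_apply]
      module
    exact hv ▸ P.neg_mem (P.smul_mem _ (hπ.map_mem _))

namespace UniformlyPositive

variable {Φ : Flow ℝ V} {C : Set V} {k : ℕ} {K : Set V} {ε M : ℝ}

theorem bound_pos (hU : UniformlyPositive Φ C k K ε M) : 0 < M := one_pos.trans_le hU.one_le

theorem le_norm (hU : UniformlyPositive Φ C k K ε M) {z : V} (hz : z ∈ K) {t : ℝ} (ht : |t| ≤ 1)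
    (v : V) : ‖v‖ ≤ M * ‖spaceDeriv Φ t z v‖ := by
  have := hU.norm_le (Φ t z) (hU.invariant z hz t) (-t) (by rwa [abs_neg]) (spaceDeriv Φ t z v)
  rwa [spaceDeriv_neg_apply hU.contDiff] at this

theorem spaceDeriv_mem_coneCore (hU : UniformlyPositive Φ C k K ε M) {z v : V}
    (hv : v ∈ coneCore Φ C z) {t : ℝ} (ht : 0 ≤ t) :
    spaceDeriv Φ t z v ∈ coneCore Φ C (Φ t z) := by
  intro n
  rw [← spaceDeriv_add_apply hU.contDiff, add_comm, spaceDeriv_add_apply hU.contDiff]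
  exact hU.mem_cone _ _ ht _ (hv n)

theorem spaceDeriv_neg_mem_coneCore (hU : UniformlyPositive Φ C k K ε M) {z v : V}
    (hv : v ∈ coneCore Φ C z) (m : ℕ) : spaceDeriv Φ (-m) z v ∈ coneCore Φ C (Φ (-m) z) := by
  intro n
  have := hv (n + m)
  rwa [Nat.cast_add, neg_add, spaceDeriv_add_apply hU.contDiff] at this

theorem coneCore_subset_deepPart (hU : UniformlyPositive Φ C k K ε M) {z : V} (hz : z ∈ K) :
    coneCore Φ C z ⊆ deepPart C ε := fun v hv => by
  have hback : spaceDeriv Φ (-1) z v ∈ C := by simpa using hv 1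
  have := hU.mem_deepPart (Φ (-1) z) (hU.invariant z hz _) _ hback
  rwa [spaceDeriv_apply_neg hU.contDiff] at this

variable [FiniteDimensional ℝ V]

theorem exists_submodule_subset_coneCore (hU : UniformlyPositive Φ C k K ε M) (z : V) :
    ∃ E : Submodule ℝ V, Module.finrank ℝ E = k ∧ (E : Set V) ⊆ coneCore Φ C z := by
  obtain ⟨W, hWC, hWk⟩ := hU.isKCone.isGreatest.1
  obtain ⟨E, hEk, φ, hφ, hlim⟩ := exists_subseq_tendsto_submodule
    (fun n : ℕ => W.map (spaceDeriv Φ n (Φ (-n) z) : V →ₗ[ℝ] V))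
    (fun n => (finrank_map_spaceDeriv hU.contDiff _ _ W).trans hWk)
  refine ⟨E, hEk, fun v hv m => ?_⟩
  obtain ⟨p, hp, hpv⟩ := hlim v hv
  refine hU.isKCone.isClosed.mem_of_tendsto
    (((spaceDeriv Φ (-m) z).continuous.tendsto v).comp hpv) ?_
  filter_upwards [eventually_ge_atTop m] with j hj
  obtain ⟨w, hw, hwp⟩ := hp j
  have hmφ : (m : ℝ) ≤ φ j := by exact_mod_cast hj.trans (hφ.id_le j)
  have hmem := hU.mem_cone (Φ (-φ j) z) (-m + φ j) (by linarith) w (hWC hw)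
  rw [spaceDeriv_add_apply hU.contDiff, flow_apply_neg] at hmem
  rwa [Function.comp_apply, ← hwp]

theorem exists_perturbed_spaceDeriv (hU : UniformlyPositive Φ C k K ε M) :
    ∃ δ : ℝ, 0 < δ ∧ ∀ z ∈ K, ∀ E : Submodule ℝ V, ∀ n : ℕ, ∃ L : V →L[ℝ] V, Set.MapsTo L C C ∧
      (∀ v ∈ E, L v = spaceDeriv Φ n z v) ∧
      ∀ w, L w - (1 + δ) ^ n • spaceDeriv Φ n z w ∈ E.map (spaceDeriv Φ n z : V →ₗ[ℝ] V) := by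
  obtain ⟨δ, hδ, hpert⟩ := exists_inward_perturbation C hU.eps_pos
  refine ⟨δ, hδ, fun z hz E n => ?_⟩
  induction n with
  | zero =>
    refine ⟨.id ℝ V, fun v hv => hv, fun v _ => ?_, fun w => ?_⟩ <;>
      simp [spaceDeriv_zero_apply]
  | succ n ih =>
    obtain ⟨L, hLC, hLE, hLw⟩ := ih
    have hstep : ∀ v, spaceDeriv Φ 1 (Φ n z) (spaceDeriv Φ n z v) =
        spaceDeriv Φ (n + 1 : ℕ) z v := fun v => by
      rw [← spaceDeriv_add_apply hU.contDiff, Nat.cast_succ, add_comm]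
    obtain ⟨A, hAC, hAP, hA⟩ := hpert (spaceDeriv Φ 1 (Φ n z))
      (E.map (spaceDeriv Φ (n + 1 : ℕ) z : V →ₗ[ℝ] V)) (hU.mem_deepPart _ (hU.invariant z hz n))
    refine ⟨A ∘L L, hAC.comp hLC, fun v hv => ?_, fun w => ?_⟩
    · change A (L v) = _
      rw [hLE v hv, ← hstep]
      exact hAP _ (hstep v ▸ Submodule.mem_map_of_mem hv)
    · obtain ⟨e, he, hew⟩ := hLw w
      have hsplit : (A ∘L L) w - (1 + δ) ^ (n + 1) • spaceDeriv Φ (n + 1 : ℕ) z w =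
          (A (L w) - (1 + δ) • spaceDeriv Φ 1 (Φ n z) (L w)) +
            (1 + δ) • spaceDeriv Φ (n + 1 : ℕ) z e := by
        have hew' : L w = (1 + δ) ^ n • spaceDeriv Φ n z w + spaceDeriv Φ n z e :=
          sub_eq_iff_eq_add'.1 hew.symm
        have hAL : spaceDeriv Φ 1 (Φ n z) (L w) = (1 + δ) ^ n • spaceDeriv Φ (n + 1 : ℕ) z w +
            spaceDeriv Φ (n + 1 : ℕ) z e := by
          rw [hew', map_add, map_smul, hstep, hstep]
        rw [ContinuousLinearMap.comp_apply, hAL]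
        module
      rw [hsplit]
      exact Submodule.add_mem _ (hA _)
        (Submodule.smul_mem _ _ (Submodule.mem_map_of_mem he))

/-- The factor `(1 + δ)⁻¹` is gained because the linearized flow still preserves the cone after
the components transverse to `E` have been enlarged by `1 + δ` at each unit of time. -/
theorem exists_exponential_domination (hU : UniformlyPositive Φ C k K ε M) :
    ∃ R r : ℝ, 0 < R ∧ 0 < r ∧ r < 1 ∧ ∀ z ∈ K, ∀ E : Submodule ℝ V, Module.finrank ℝ E = k →
      (E : Set V) ⊆ coneCore Φ C z → ∀ n : ℕ, ∀ v ∈ E, ∀ w, ∃ e ∈ E,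
        ‖v‖ * ‖spaceDeriv Φ n z (w - e)‖ ≤ R * r ^ n * ‖spaceDeriv Φ n z v‖ * ‖w‖ := by
  obtain ⟨R, hR, hdom⟩ := hU.isKCone.exists_domination hU.eps_pos
  obtain ⟨δ, hδ, hpert⟩ := hU.exists_perturbed_spaceDeriv
  refine ⟨R, (1 + δ)⁻¹, hR, by positivity, inv_lt_one_of_one_lt₀ (by linarith), ?_⟩
  intro z hz E hEk hEC n v hv w
  obtain ⟨L, hLC, hLE, hLw⟩ := hpert z hz E n
  have hLE' : E.map (L : V →ₗ[ℝ] V) = E.map (spaceDeriv Φ n z : V →ₗ[ℝ] V) :=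
    SetLike.coe_injective (Set.image_congr hLE)
  obtain ⟨e, he, hdom_e⟩ := hdom L E (by rw [hLE', finrank_map_spaceDeriv hU.contDiff, hEk]) hLC
    (hEC.trans (hU.coneCore_subset_deepPart hz)) v hv w
  obtain ⟨e₁, he₁, hew⟩ := hLw w
  have hp : 0 < (1 + δ) ^ n := by positivity
  refine ⟨((1 + δ) ^ n)⁻¹ • (e - e₁), E.smul_mem _ (E.sub_mem he he₁), ?_⟩
  have hdiff : spaceDeriv Φ n z (w - ((1 + δ) ^ n)⁻¹ • (e - e₁)) =
      ((1 + δ) ^ n)⁻¹ • (L w - L e) := by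
    have hew' : L w = (1 + δ) ^ n • spaceDeriv Φ n z w + spaceDeriv Φ n z e₁ :=
      sub_eq_iff_eq_add'.1 hew.symm
    rw [hew', hLE e he, map_sub, map_smul, map_sub, eq_inv_smul_iff₀ hp.ne', smul_sub,
      smul_inv_smul₀ hp.ne']
    abel
  rw [hdiff, norm_smul, norm_inv, Real.norm_of_nonneg hp.le, inv_pow]
  rw [hLE v hv] at hdom_e
  calc ‖v‖ * (((1 + δ) ^ n)⁻¹ * ‖L w - L e‖)
      = ((1 + δ) ^ n)⁻¹ * (‖v‖ * ‖L w - L e‖) := by ring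
    _ ≤ ((1 + δ) ^ n)⁻¹ * (R * ‖spaceDeriv Φ n z v‖ * ‖w‖) := by gcongr
    _ = R * ((1 + δ) ^ n)⁻¹ * ‖spaceDeriv Φ n z v‖ * ‖w‖ := by ring

end UniformlyPositive

theorem exists_norm_apply_sub_le [FiniteDimensional ℝ V] (A : V →L[ℝ] V) (E : Submodule ℝ V)
    (x : V) : ∃ u ∈ E, ∀ e ∈ E, ‖A (x - u)‖ ≤ ‖A (x - e)‖ := by
  have := FiniteDimensional.proper_real V
  obtain ⟨_, ⟨u, hu, rfl⟩, hdist⟩ := (Submodule.closed_of_finiteDimensional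
    (E.map (A : V →ₗ[ℝ] V))).exists_infDist_eq_dist (Submodule.nonempty _) (A x)
  refine ⟨u, hu, fun e he => ?_⟩
  have hle := Metric.infDist_le_dist_of_mem (x := A x) (Submodule.mem_map_of_mem
    (f := (A : V →ₗ[ℝ] V)) he)
  rw [hdist] at hle
  simpa [map_sub, dist_eq_norm] using hle

/-- The vectors that the operators `S n` make smaller, at the rate `r`, than all vectors of `E`. -/
def fastSpace (S : ℕ → V →L[ℝ] V) (r : ℝ) (E : Submodule ℝ V) : Submodule ℝ V where
  carrier := {f | ∃ a : ℝ, 0 ≤ a ∧ ∀ n, ∀ v ∈ E, ‖v‖ * ‖S n f‖ ≤ a * r ^ n * ‖S n v‖}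
  zero_mem' := ⟨0, le_rfl, fun n v _ => by simp⟩
  add_mem' := by
    rintro f g ⟨a, ha0, ha⟩ ⟨b, hb0, hb⟩
    refine ⟨a + b, add_nonneg ha0 hb0, fun n v hv => ?_⟩
    calc ‖v‖ * ‖S n (f + g)‖ ≤ ‖v‖ * (‖S n f‖ + ‖S n g‖) := by
          rw [map_add]
          gcongr
          exact norm_add_le _ _
      _ ≤ (a + b) * r ^ n * ‖S n v‖ := by linarith [ha n v hv, hb n v hv]
  smul_mem' := by
    rintro l f ⟨a, ha0, ha⟩
    refine ⟨‖l‖ * a, mul_nonneg (norm_nonneg l) ha0, fun n v hv => ?_⟩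
    calc ‖v‖ * ‖S n (l • f)‖ = ‖l‖ * (‖v‖ * ‖S n f‖) := by rw [map_smul, norm_smul]; ring
      _ ≤ ‖l‖ * (a * r ^ n * ‖S n v‖) := mul_le_mul_of_nonneg_left (ha n v hv) (norm_nonneg l)
      _ = ‖l‖ * a * r ^ n * ‖S n v‖ := by ring

/-- `E` dominates its complement along the products `S n`: from any time on, every vector can be
corrected by an element of `E` so that it grows slower than the vectors of `E` by the factor
`r ^ j` in `j` steps.  Each step changes norms by a factor of at most `M`. -/
structure Dominates (S : ℕ → V →L[ℝ] V) (E : Submodule ℝ V) (M R r : ℝ) : Prop where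
  step_bound_nonneg : 0 ≤ M
  const_nonneg : 0 ≤ R
  rate_pos : 0 < r
  rate_lt_one : r < 1
  zero_apply : ∀ v, S 0 v = v
  norm_succ_le : ∀ n v, ‖S (n + 1) v‖ ≤ M * ‖S n v‖
  le_norm_succ : ∀ n v, ‖S n v‖ ≤ M * ‖S (n + 1) v‖
  exists_correction : ∀ n j, ∀ v ∈ E, ∀ w, ∃ e ∈ E,
    ‖S n v‖ * ‖S (n + j) (w - e)‖ ≤ R * r ^ j * ‖S (n + j) v‖ * ‖S n w‖

namespace Dominates

variable {S : ℕ → V →L[ℝ] V} {E : Submodule ℝ V} {M R r : ℝ}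

theorem eq_zero_of_apply_eq_zero (h : Dominates S E M R r) (n : ℕ) {v : V} (hv : S n v = 0) :
    v = 0 := by
  induction n with
  | zero => rwa [h.zero_apply] at hv
  | succ n ih => exact ih (norm_le_zero_iff.1 (by simpa [hv] using h.le_norm_succ n v))

theorem disjoint_fastSpace (h : Dominates S E M R r) : Disjoint E (fastSpace S r E) := by
  rw [Submodule.disjoint_def]
  rintro x hx ⟨a, -, ha⟩
  by_contra hx0
  have hle : ∀ n, ‖x‖ ≤ a * r ^ n := fun n =>
    le_of_mul_le_mul_right (ha n x hx)
      (norm_pos_iff.2 fun hn => hx0 (h.eq_zero_of_apply_eq_zero n hn))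
  have hlim : Tendsto (fun n => a * r ^ n) atTop (𝓝 0) := by
    simpa using (tendsto_pow_atTop_nhds_zero_of_lt_one h.rate_pos.le h.rate_lt_one).const_mul a
  exact hx0 (norm_le_zero_iff.1 (ge_of_tendsto' hlim hle))

section NearestPoints

variable {x : V} {u : ℕ → V} (hu : ∀ n, u n ∈ E)
  (hmin : ∀ n, ∀ e ∈ E, ‖S n (x - u n)‖ ≤ ‖S n (x - e)‖)
include hu hmin

theorem norm_nearest_succ_sub_le (h : Dominates S E M R r) (n : ℕ) :
    ‖S n (u (n + 1) - u n)‖ ≤ 2 * M ^ 2 * ‖S n (x - u n)‖ := by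
  have hM := h.step_bound_nonneg
  have htri : ‖S (n + 1) (u (n + 1) - u n)‖ ≤ 2 * ‖S (n + 1) (x - u n)‖ :=
    calc ‖S (n + 1) (u (n + 1) - u n)‖
        = ‖S (n + 1) (x - u n) - S (n + 1) (x - u (n + 1))‖ := by rw [← map_sub]; congr 2; abel
      _ ≤ ‖S (n + 1) (x - u n)‖ + ‖S (n + 1) (x - u (n + 1))‖ := norm_sub_le _ _
      _ ≤ 2 * ‖S (n + 1) (x - u n)‖ := by linarith [hmin (n + 1) (u n) (hu n)]
  calc ‖S n (u (n + 1) - u n)‖ ≤ M * ‖S (n + 1) (u (n + 1) - u n)‖ := h.le_norm_succ n _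
    _ ≤ M * (2 * (M * ‖S n (x - u n)‖)) := by
        gcongr
        exact htri.trans (by gcongr; exact h.norm_succ_le n _)
    _ = 2 * M ^ 2 * ‖S n (x - u n)‖ := by ring

theorem norm_nearest_step_le_geometric (h : Dominates S E M R r) (n j : ℕ) :
    ‖S n (u (n + j + 1) - u (n + j))‖ ≤ 2 * M ^ 2 * R * ‖S n (x - u n)‖ * r ^ j := by
  have hR := h.const_nonneg
  have hr := h.rate_pos
  have hstep := h.norm_nearest_succ_sub_le hu hmin (n + j)
  set d := u (n + j + 1) - u (n + j)
  obtain ⟨e, he, hdom⟩ := h.exists_correction n j d (E.sub_mem (hu _) (hu _)) (x - u n)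
  have hnear : ‖S (n + j) (x - u (n + j))‖ ≤ ‖S (n + j) (x - u n - e)‖ := by
    simpa only [sub_sub] using hmin (n + j) (u n + e) (E.add_mem (hu n) he)
  rcases (norm_nonneg (S (n + j) (x - u (n + j)))).eq_or_lt with h0 | h0
  · rw [← h0, mul_zero] at hstep
    rw [h.eq_zero_of_apply_eq_zero _ (norm_le_zero_iff.1 hstep), map_zero, norm_zero]
    positivity
  · refine le_of_mul_le_mul_right ?_ h0
    calc ‖S n d‖ * ‖S (n + j) (x - u (n + j))‖
        ≤ R * r ^ j * ‖S (n + j) d‖ * ‖S n (x - u n)‖ :=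
          (mul_le_mul_of_nonneg_left hnear (norm_nonneg _)).trans hdom
      _ ≤ R * r ^ j * (2 * M ^ 2 * ‖S (n + j) (x - u (n + j))‖) * ‖S n (x - u n)‖ := by gcongr
      _ = 2 * M ^ 2 * R * ‖S n (x - u n)‖ * r ^ j * ‖S (n + j) (x - u (n + j))‖ := by ring

theorem exists_tendsto_nearest [FiniteDimensional ℝ V] (h : Dominates S E M R r) :
    ∃ a ∈ E, Tendsto u atTop (𝓝 a) := by
  have hcauchy : CauchySeq u := by
    refine cauchySeq_of_le_geometric r (2 * M ^ 2 * R * ‖S 0 (x - u 0)‖) h.rate_lt_one fun j => ?_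
    have := h.norm_nearest_step_le_geometric hu hmin 0 j
    rwa [h.zero_apply, zero_add, ← dist_eq_norm, dist_comm] at this
  obtain ⟨a, ha⟩ := cauchySeq_tendsto_of_complete hcauchy
  exact ⟨a, (Submodule.closed_of_finiteDimensional E).mem_of_tendsto ha (.of_forall hu), ha⟩

theorem norm_apply_sub_limit_le (h : Dominates S E M R r) {a : V} (ha : Tendsto u atTop (𝓝 a))
    (n : ℕ) : ‖S n (x - a)‖ ≤ (1 + 2 * M ^ 2 * R / (1 - r)) * ‖S n (x - u n)‖ := by
  have hdist : ‖S n (u n - a)‖ ≤ 2 * M ^ 2 * R * ‖S n (x - u n)‖ / (1 - r) := by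
    rw [map_sub, ← dist_eq_norm]
    refine dist_le_of_le_geometric_of_tendsto₀ r (2 * M ^ 2 * R * ‖S n (x - u n)‖) h.rate_lt_one
      (f := fun j => S n (u (n + j))) (fun j => ?_)
      (((S n).continuous.tendsto a).comp
        (ha.comp (tendsto_atTop_mono (fun j => Nat.le_add_left j n) tendsto_id)))
    rw [dist_comm, dist_eq_norm, ← map_sub]
    exact h.norm_nearest_step_le_geometric hu hmin n j
  calc ‖S n (x - a)‖ = ‖S n (x - u n) + S n (u n - a)‖ := by rw [← map_add, sub_add_sub_cancel]
    _ ≤ ‖S n (x - u n)‖ + ‖S n (u n - a)‖ := norm_add_le _ _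
    _ ≤ ‖S n (x - u n)‖ + 2 * M ^ 2 * R * ‖S n (x - u n)‖ / (1 - r) := by gcongr
    _ = (1 + 2 * M ^ 2 * R / (1 - r)) * ‖S n (x - u n)‖ := by ring

end NearestPoints

variable [FiniteDimensional ℝ V]

/-- The component of `x` in `E` is the limit of the points of `E` that are nearest to `x` in the
seminorms `‖S n ·‖`. -/
theorem exists_component (h : Dominates S E M R r) (x : V) :
    ∃ a ∈ E, ∀ n, ∀ v ∈ E, ‖v‖ * ‖S n (x - a)‖ ≤
      (1 + 2 * M ^ 2 * R / (1 - r)) * R * ‖x‖ * r ^ n * ‖S n v‖ := by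
  have hc : 0 ≤ 2 * M ^ 2 * R / (1 - r) :=
    div_nonneg (mul_nonneg (by positivity) h.const_nonneg) (by linarith [h.rate_lt_one])
  choose u hu hmin using fun n => exists_norm_apply_sub_le (S n) E x
  obtain ⟨a, haE, ha⟩ := h.exists_tendsto_nearest hu hmin
  refine ⟨a, haE, fun n v hv => ?_⟩
  obtain ⟨e, he, hdom⟩ := h.exists_correction 0 n v hv x
  rw [zero_add, h.zero_apply, h.zero_apply] at hdom
  calc ‖v‖ * ‖S n (x - a)‖
      ≤ ‖v‖ * ((1 + 2 * M ^ 2 * R / (1 - r)) * ‖S n (x - e)‖) := by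
        gcongr
        exact (h.norm_apply_sub_limit_le hu hmin ha n).trans (by gcongr; exact hmin n e he)
    _ = (1 + 2 * M ^ 2 * R / (1 - r)) * (‖v‖ * ‖S n (x - e)‖) := by ring
    _ ≤ (1 + 2 * M ^ 2 * R / (1 - r)) * (R * r ^ n * ‖S n v‖ * ‖x‖) := by gcongr
    _ = (1 + 2 * M ^ 2 * R / (1 - r)) * R * ‖x‖ * r ^ n * ‖S n v‖ := by ring

theorem isCompl_fastSpace (h : Dominates S E M R r) : IsCompl E (fastSpace S r E) := by
  refine ⟨h.disjoint_fastSpace, codisjoint_iff.2 (Submodule.eq_top_iff'.2 fun x => ?_)⟩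
  obtain ⟨a, haE, ha⟩ := h.exists_component x
  have hR := h.const_nonneg
  have hr : 0 < 1 - r := by linarith [h.rate_lt_one]
  exact Submodule.mem_sup.2 ⟨a, haE, x - a, ⟨_, by positivity, ha⟩, add_sub_cancel a x⟩

theorem norm_apply_le_of_mem_fastSpace (h : Dominates S E M R r) {f : V}
    (hf : f ∈ fastSpace S r E) (n : ℕ) {v : V} (hv : v ∈ E) :
    ‖v‖ * ‖S n f‖ ≤ (1 + 2 * M ^ 2 * R / (1 - r)) * R * ‖f‖ * r ^ n * ‖S n v‖ := by
  obtain ⟨a, haE, ha⟩ := h.exists_component f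
  have hR := h.const_nonneg
  have hr : 0 < 1 - r := by linarith [h.rate_lt_one]
  have hfa : f - a ∈ fastSpace S r E := ⟨_, by positivity, ha⟩
  have haF : a ∈ fastSpace S r E := by simpa using Submodule.sub_mem _ hf hfa
  have ha0 : a = 0 := Submodule.disjoint_def.1 h.disjoint_fastSpace a haE haF
  simpa [ha0] using ha n v hv

end Dominates

/-- `E` is a `k`-dimensional subspace of the cone core at `z`. -/
structure IsCoreSubspace (Φ : Flow ℝ V) (C : Set V) (k : ℕ) (z : V) (E : Submodule ℝ V) :
    Prop where
  finrank_eq : Module.finrank ℝ E = k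
  subset_coneCore : (E : Set V) ⊆ coneCore Φ C z

/-- The derivatives at `z` of the time-`n` maps. -/
noncomputable def derivSeq (Φ : Flow ℝ V) (z : V) (n : ℕ) : V →L[ℝ] V := spaceDeriv Φ n z

namespace UniformlyPositive

variable {Φ : Flow ℝ V} {C : Set V} {k : ℕ} {K : Set V} {ε M : ℝ}

theorem isCoreSubspace_map (hU : UniformlyPositive Φ C k K ε M) {z : V} {E : Submodule ℝ V}
    (hE : IsCoreSubspace Φ C k z E) {t : ℝ} (ht : 0 ≤ t) :
    IsCoreSubspace Φ C k (Φ t z) (E.map (spaceDeriv Φ t z : V →ₗ[ℝ] V)) where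
  finrank_eq := (finrank_map_spaceDeriv hU.contDiff t z E).trans hE.finrank_eq
  subset_coneCore := by
    rintro _ ⟨v, hv, rfl⟩
    exact hU.spaceDeriv_mem_coneCore (hE.subset_coneCore hv) ht

theorem isCoreSubspace_map_neg (hU : UniformlyPositive Φ C k K ε M) {z : V} {E : Submodule ℝ V}
    (hE : IsCoreSubspace Φ C k z E) (n : ℕ) :
    IsCoreSubspace Φ C k (Φ (-n) z) (E.map (spaceDeriv Φ (-n) z : V →ₗ[ℝ] V)) where
  finrank_eq := (finrank_map_spaceDeriv hU.contDiff _ z E).trans hE.finrank_eq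
  subset_coneCore := by
    rintro _ ⟨v, hv, rfl⟩
    exact hU.spaceDeriv_neg_mem_coneCore (hE.subset_coneCore hv) n

theorem derivSeq_succ_apply (hU : UniformlyPositive Φ C k K ε M) (z v : V) (n : ℕ) :
    derivSeq Φ z (n + 1) v = spaceDeriv Φ 1 (Φ n z) (derivSeq Φ z n v) := by
  rw [derivSeq, Nat.cast_succ, add_comm, spaceDeriv_add_apply hU.contDiff, derivSeq]

theorem derivSeq_add_apply (hU : UniformlyPositive Φ C k K ε M) (z v : V) (n j : ℕ) :
    derivSeq Φ z (n + j) v = derivSeq Φ (Φ n z) j (derivSeq Φ z n v) := by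
  rw [derivSeq, Nat.cast_add, add_comm, spaceDeriv_add_apply hU.contDiff, derivSeq, derivSeq]

theorem derivSeq_spaceDeriv_apply (hU : UniformlyPositive Φ C k K ε M) (z v : V) (n : ℕ)
    (t : ℝ) : derivSeq Φ (Φ t z) n (spaceDeriv Φ t z v) =
      spaceDeriv Φ t (Φ n z) (derivSeq Φ z n v) := by
  rw [derivSeq, derivSeq, ← spaceDeriv_add_apply hU.contDiff, ← spaceDeriv_add_apply hU.contDiff,
    add_comm]

theorem spaceDeriv_mem_fastSpace (hU : UniformlyPositive Φ C k K ε M) {r : ℝ} (hr : 0 ≤ r) {z : V}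
    (hz : z ∈ K) {E : Submodule ℝ V} {f : V} (hf : f ∈ fastSpace (derivSeq Φ z) r E) (t : ℝ) :
    spaceDeriv Φ t z f ∈
      fastSpace (derivSeq Φ (Φ t z)) r (E.map (spaceDeriv Φ t z : V →ₗ[ℝ] V)) := by
  obtain ⟨a, ha0, ha⟩ := hf
  obtain ⟨B, hB1, hB⟩ := exists_norm_spaceDeriv_le hU.contDiff hU.isCompact |t|
  refine ⟨B ^ 3 * a, by positivity, ?_⟩
  rintro n _ ⟨v, hv, rfl⟩
  change ‖spaceDeriv Φ t z v‖ * ‖derivSeq Φ (Φ t z) n (spaceDeriv Φ t z f)‖ ≤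
    B ^ 3 * a * r ^ n * ‖derivSeq Φ (Φ t z) n (spaceDeriv Φ t z v)‖
  rw [hU.derivSeq_spaceDeriv_apply, hU.derivSeq_spaceDeriv_apply]
  have hzn := hU.invariant z hz n
  have hback : ‖derivSeq Φ z n v‖ ≤ B * ‖spaceDeriv Φ t (Φ n z) (derivSeq Φ z n v)‖ := by
    have := hB _ (hU.invariant _ hzn t) (-t) (abs_neg t).le
      (spaceDeriv Φ t (Φ n z) (derivSeq Φ z n v))
    rwa [spaceDeriv_neg_apply hU.contDiff] at this
  calc ‖spaceDeriv Φ t z v‖ * ‖spaceDeriv Φ t (Φ n z) (derivSeq Φ z n f)‖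
      ≤ (B * ‖v‖) * (B * ‖derivSeq Φ z n f‖) := by
        gcongr
        exacts [hB z hz t le_rfl v, hB _ hzn t le_rfl _]
    _ = B ^ 2 * (‖v‖ * ‖derivSeq Φ z n f‖) := by ring
    _ ≤ B ^ 2 * (a * r ^ n * (B * ‖spaceDeriv Φ t (Φ n z) (derivSeq Φ z n v)‖)) := by
        refine mul_le_mul_of_nonneg_left ((ha n v hv).trans ?_) (by positivity)
        gcongr
    _ = B ^ 3 * a * r ^ n * ‖spaceDeriv Φ t (Φ n z) (derivSeq Φ z n v)‖ := by ring

theorem exists_dominates [FiniteDimensional ℝ V] (hU : UniformlyPositive Φ C k K ε M) :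
    ∃ R r : ℝ, 0 < R ∧ 0 < r ∧ r < 1 ∧
      ∀ z ∈ K, ∀ E, IsCoreSubspace Φ C k z E → Dominates (derivSeq Φ z) E M R r := by
  obtain ⟨R, r, hR, hr0, hr1, hdom⟩ := hU.exists_exponential_domination
  refine ⟨R, r, hR, hr0, hr1, fun z hz E hE =>
    ⟨hU.bound_pos.le, hR.le, hr0, hr1, fun v => ?_, fun n v => ?_, fun n v => ?_,
      fun n j v hv w => ?_⟩⟩
  · rw [derivSeq, Nat.cast_zero, spaceDeriv_zero_apply]
  · rw [hU.derivSeq_succ_apply]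
    exact hU.norm_le _ (hU.invariant z hz n) 1 abs_one.le _
  · rw [hU.derivSeq_succ_apply]
    exact hU.le_norm (hU.invariant z hz n) abs_one.le _
  · have hEn := hU.isCoreSubspace_map hE n.cast_nonneg
    obtain ⟨_, ⟨e, he, rfl⟩, hcorr⟩ := hdom (Φ n z) (hU.invariant z hz n) _ hEn.finrank_eq
      hEn.subset_coneCore j (derivSeq Φ z n v) ⟨v, hv, rfl⟩ (derivSeq Φ z n w)
    refine ⟨e, he, ?_⟩
    rw [hU.derivSeq_add_apply, hU.derivSeq_add_apply, map_sub (derivSeq Φ z n)]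
    exact hcorr

/-- If `u` is small compared with `f` after time one, then the inward push on `f` absorbs it;
otherwise it dominates `f` after a time that depends only on `f`. -/
theorem exists_forall_add_mem_cone (hU : UniformlyPositive Φ C k K ε M) {z : V} (hz : z ∈ K)
    {E : Submodule ℝ V} (hE : (E : Set V) ⊆ coneCore Φ C z) {r : ℝ} (hr0 : 0 ≤ r) (hr1 : r < 1)
    {f : V} (hf : f ∈ fastSpace (derivSeq Φ z) r E) (hfC : f ∈ C) (hf0 : f ≠ 0) :
    ∃ n, ∀ u ∈ E, derivSeq Φ z n (f + u) ∈ C := by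
  obtain ⟨a, -, ha⟩ := hf
  have hε := hU.eps_pos
  have hM := hU.bound_pos
  have hf1 : 0 < ‖spaceDeriv Φ 1 z f‖ :=
    norm_pos_iff.2 ((map_ne_zero_iff _ (spaceDeriv_injective hU.contDiff 1 z)).2 hf0)
  have hlim : Tendsto (fun n : ℕ => a * r ^ n) atTop (𝓝 0) := by
    simpa using (tendsto_pow_atTop_nhds_zero_of_lt_one hr0 hr1).const_mul a
  have hδ : 0 < ε * (ε * ‖spaceDeriv Φ 1 z f‖ / M) := by positivity
  obtain ⟨n, hn, hn1⟩ := ((hlim.eventually (gt_mem_nhds hδ)).and (eventually_ge_atTop 1)).exists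
  refine ⟨n, fun u hu => ?_⟩
  by_cases hsmall : ‖spaceDeriv Φ 1 z u‖ ≤ ε * ‖spaceDeriv Φ 1 z f‖
  · have hone : spaceDeriv Φ 1 z (f + u) ∈ C := by
      rw [map_add]
      exact hU.mem_deepPart z hz f hfC _ hsmall
    obtain ⟨m, rfl⟩ := Nat.exists_eq_add_of_le hn1
    rw [hU.derivSeq_add_apply]
    refine hU.mem_cone _ _ m.cast_nonneg _ ?_
    rwa [derivSeq, Nat.cast_one]
  · have hu_large : ε * ‖spaceDeriv Φ 1 z f‖ / M < ‖u‖ := by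
      rw [div_lt_iff₀' hM]
      exact (not_le.1 hsmall).trans_le (hU.norm_le z hz 1 abs_one.le u)
    have hdeep : derivSeq Φ z n u ∈ deepPart C ε :=
      hU.coneCore_subset_deepPart (hU.invariant z hz n)
        (hU.spaceDeriv_mem_coneCore (hE hu) n.cast_nonneg)
    rw [map_add, add_comm]
    refine hdeep _ (le_of_mul_le_mul_left ?_ ((by positivity : (0 : ℝ) < _).trans hu_large))
    calc ‖u‖ * ‖derivSeq Φ z n f‖ ≤ a * r ^ n * ‖derivSeq Φ z n u‖ := ha n u hu
      _ ≤ ε * ‖u‖ * ‖derivSeq Φ z n u‖ :=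
          mul_le_mul_of_nonneg_right (hn.le.trans (by gcongr)) (norm_nonneg _)
      _ = ‖u‖ * (ε * ‖derivSeq Φ z n u‖) := by ring

theorem spaceDeriv_one_mem_cone_of_add_mem (hU : UniformlyPositive Φ C k K ε M) {z : V}
    (hz : z ∈ K) {u f : V} (huf : u + f ∈ C) (hsmall : ‖u‖ ≤ ε / (M ^ 2 + ε) * ‖f‖) :
    spaceDeriv Φ 1 z f ∈ C := by
  have hε := hU.eps_pos
  have hM := hU.bound_pos
  have hu : M ^ 2 * ‖u‖ ≤ ε * ‖u + f‖ := by
    rw [div_mul_eq_mul_div, le_div_iff₀ (by positivity)] at hsmall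
    have htri : ‖f‖ ≤ ‖u + f‖ + ‖u‖ := by simpa using norm_sub_le (u + f) u
    nlinarith
  have hpush := hU.mem_deepPart z hz _ huf (-spaceDeriv Φ 1 z u) (by
    rw [norm_neg]
    refine le_of_mul_le_mul_left ?_ hM
    calc M * ‖spaceDeriv Φ 1 z u‖ ≤ M * (M * ‖u‖) := by
          gcongr
          exact hU.norm_le z hz 1 abs_one.le u
      _ = M ^ 2 * ‖u‖ := by ring
      _ ≤ ε * (M * ‖spaceDeriv Φ 1 z (u + f)‖) :=
          hu.trans (by gcongr; exact hU.le_norm hz abs_one.le _)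
      _ = M * (ε * ‖spaceDeriv Φ 1 z (u + f)‖) := by ring)
  rwa [map_add, add_neg_cancel_comm] at hpush

variable [FiniteDimensional ℝ V] {E : Submodule ℝ V} {R r : ℝ}

/-- The sum of `E` and the line spanned by `f` is eventually mapped into the cone, which contains
no subspace of dimension `k + 1`. -/
theorem eq_zero_of_mem_fastSpace_of_mem_cone (hU : UniformlyPositive Φ C k K ε M) {z : V}
    (hz : z ∈ K) (hE : IsCoreSubspace Φ C k z E) (hD : Dominates (derivSeq Φ z) E M R r) {f : V}
    (hf : f ∈ fastSpace (derivSeq Φ z) r E) (hfC : f ∈ C) : f = 0 := by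
  by_contra hf0
  obtain ⟨n, hn⟩ := hU.exists_forall_add_mem_cone hz hE.subset_coneCore hD.rate_pos.le
    hD.rate_lt_one hf hfC hf0
  have hEn := hU.isCoreSubspace_map hE n.cast_nonneg
  obtain ⟨u, hu, huf⟩ := hU.isKCone.mem_of_forall_add_mem hEn.finrank_eq
    (hEn.subset_coneCore.trans (coneCore_subset_cone _ _ _)) (w := derivSeq Φ z n f) (by
      rintro _ ⟨u, hu, rfl⟩
      change derivSeq Φ z n u + derivSeq Φ z n f ∈ C
      rw [← map_add, add_comm]
      exact hn u hu)
  rw [← spaceDeriv_injective hU.contDiff n z huf] at hf0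
  rw [← spaceDeriv_injective hU.contDiff n z huf] at hf
  exact hf0 (Submodule.disjoint_def.1 hD.disjoint_fastSpace u hu hf)

theorem eventually_norm_spaceDeriv_neg_le (hU : UniformlyPositive Φ C k K ε M)
    (hD : ∀ z ∈ K, ∀ E, IsCoreSubspace Φ C k z E → Dominates (derivSeq Φ z) E M R r) {z : V}
    (hz : z ∈ K) (hE : IsCoreSubspace Φ C k z E) {u f : V} (hu : u ∈ E)
    (hf : f ∈ fastSpace (derivSeq Φ z) r E) (hf0 : f ≠ 0) {q : ℝ} (hq : 0 < q) :
    ∀ᶠ n : ℕ in atTop, ‖spaceDeriv Φ (-n) z u‖ ≤ q * ‖spaceDeriv Φ (-n) z f‖ := by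
  have hDz := hD z hz E hE
  set c := (1 + 2 * M ^ 2 * R / (1 - r)) * R
  have hlim : Tendsto (fun n : ℕ => c * ‖u‖ * r ^ n) atTop (𝓝 0) := by
    simpa using (tendsto_pow_atTop_nhds_zero_of_lt_one hDz.rate_pos.le
      hDz.rate_lt_one).const_mul (c * ‖u‖)
  filter_upwards [hlim.eventually
    (gt_mem_nhds (mul_pos hq (norm_pos_iff.2 hf0)))] with n hn
  have hdom := (hD _ (hU.invariant z hz (-n)) _
    (hU.isCoreSubspace_map_neg hE n)).norm_apply_le_of_mem_fastSpace
    (hU.spaceDeriv_mem_fastSpace hDz.rate_pos.le hz hf (-n)) n (Submodule.mem_map_of_mem hu)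
  change ‖spaceDeriv Φ (-n) z u‖ * ‖spaceDeriv Φ n _ (spaceDeriv Φ (-n) z f)‖ ≤
    c * ‖spaceDeriv Φ (-n) z f‖ * r ^ n * ‖spaceDeriv Φ n _ (spaceDeriv Φ (-n) z u)‖ at hdom
  rw [spaceDeriv_apply_neg hU.contDiff, spaceDeriv_apply_neg hU.contDiff] at hdom
  refine le_of_mul_le_mul_right ?_ (norm_pos_iff.2 hf0)
  calc ‖spaceDeriv Φ (-n) z u‖ * ‖f‖ ≤ c * ‖u‖ * r ^ n * ‖spaceDeriv Φ (-n) z f‖ := by linarith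
    _ ≤ q * ‖f‖ * ‖spaceDeriv Φ (-n) z f‖ := by gcongr
    _ = q * ‖spaceDeriv Φ (-n) z f‖ * ‖f‖ := by ring

/-- Far back in the past the `E`-component of a core vector is negligible, so its other
component enters the cone. -/
theorem coneCore_subset_of_isCoreSubspace (hU : UniformlyPositive Φ C k K ε M)
    (hD : ∀ z ∈ K, ∀ E, IsCoreSubspace Φ C k z E → Dominates (derivSeq Φ z) E M R r) {z : V}
    (hz : z ∈ K) (hE : IsCoreSubspace Φ C k z E) : coneCore Φ C z ⊆ E := by
  intro v hv
  have hDz := hD z hz E hE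
  obtain ⟨u, hu, f, hf, rfl⟩ := Submodule.mem_sup.1
    (hDz.isCompl_fastSpace.sup_eq_top.ge (Submodule.mem_top (x := v)))
  by_cases hf0 : f = 0
  · simpa [hf0] using hu
  have hε := hU.eps_pos
  obtain ⟨n, hn⟩ := (hU.eventually_norm_spaceDeriv_neg_le hD hz hE hu hf hf0
    (q := ε / (M ^ 2 + ε)) (by positivity)).exists
  have hzn := hU.invariant z hz (-n)
  have hEn := hU.isCoreSubspace_map (hU.isCoreSubspace_map_neg hE n) zero_le_one
  have hzero := hU.eq_zero_of_mem_fastSpace_of_mem_cone (hU.invariant _ hzn 1) hEn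
    (hD _ (hU.invariant _ hzn 1) _ hEn)
    (hU.spaceDeriv_mem_fastSpace hDz.rate_pos.le hzn
      (hU.spaceDeriv_mem_fastSpace hDz.rate_pos.le hz hf (-n)) 1)
    (hU.spaceDeriv_one_mem_cone_of_add_mem hzn (by rw [← map_add]; exact hv n) hn)
  rw [map_eq_zero_iff _ (spaceDeriv_injective hU.contDiff _ _),
    map_eq_zero_iff _ (spaceDeriv_injective hU.contDiff _ _)] at hzero
  exact absurd hzero hf0

end UniformlyPositive

theorem tendsto_spaceDeriv_apply {Φ : Flow ℝ V} (h : ContDiff ℝ 1 fun p : ℝ × V => Φ p.1 p.2)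
    (t : ℝ) {ι : Type*} {l : Filter ι} {z v : ι → V} {z₀ v₀ : V} (hz : Tendsto z l (𝓝 z₀))
    (hv : Tendsto v l (𝓝 v₀)) :
    Tendsto (fun j => spaceDeriv Φ t (z j) (v j)) l (𝓝 (spaceDeriv Φ t z₀ v₀)) := by
  have hcont : Continuous fun p : V × V => spaceDeriv Φ t p.1 p.2 :=
    ((continuous_spaceDeriv h).comp (continuous_const.prodMk continuous_fst)).clm_apply
      continuous_snd
  exact (hcont.tendsto (z₀, v₀)).comp (hz.prodMk_nhds hv)

namespace UniformlyPositive

variable {Φ : Flow ℝ V} {C : Set V} {k : ℕ} {K : Set V} {ε M R r : ℝ} {E : V → Submodule ℝ V}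

theorem hasClosedGraph_coneCore (hU : UniformlyPositive Φ C k K ε M)
    (hE : ∀ z ∈ K, (E z : Set V) = coneCore Φ C z) : HasClosedGraph K E := by
  intro z z₀ hz hz₀ hlim v v₀ hv hvlim
  rw [← SetLike.mem_coe, hE z₀ hz₀]
  refine fun n => hU.isKCone.isClosed.mem_of_tendsto
    (tendsto_spaceDeriv_apply hU.contDiff (-n) hlim hvlim) (.of_forall fun j => ?_)
  exact (hE _ (hz j)).le (hv j) n

theorem norm_spaceDeriv_le_of_norm_derivSeq_le (hU : UniformlyPositive Φ C k K ε M) {z : V}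
    (hz : z ∈ K) {c : ℝ} (hc : 0 ≤ c) (hr0 : 0 < r) (hr1 : r < 1) {v w : V}
    (h : ∀ n, ‖derivSeq Φ z n w‖ ≤ c * r ^ n * ‖derivSeq Φ z n v‖) {t : ℝ} (ht : 0 ≤ t) :
    ‖spaceDeriv Φ t z w‖ ≤ M ^ 2 * c / r * r ^ t * ‖spaceDeriv Φ t z v‖ := by
  have hM := hU.bound_pos
  set n := ⌊t⌋₊
  have hnt : (n : ℝ) ≤ t := Nat.floor_le ht
  have htn : t < n + 1 := Nat.lt_floor_add_one t
  have hsplit : ∀ y, spaceDeriv Φ t z y = spaceDeriv Φ (t - n) (Φ n z) (derivSeq Φ z n y) :=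
    fun y => by rw [derivSeq, ← spaceDeriv_add_apply hU.contDiff, sub_add_cancel]
  have habs : |t - n| ≤ 1 := abs_le.2 ⟨by linarith, by linarith⟩
  have hzn := hU.invariant z hz n
  have hpow : r ^ n ≤ r ^ t / r := by
    rw [le_div_iff₀ hr0, ← pow_succ, ← Real.rpow_natCast]
    exact Real.rpow_le_rpow_of_exponent_ge hr0 hr1.le (by push_cast; exact htn.le)
  rw [hsplit w, hsplit v]
  calc ‖spaceDeriv Φ (t - n) (Φ n z) (derivSeq Φ z n w)‖
      ≤ M * (c * r ^ n * ‖derivSeq Φ z n v‖) :=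
        (hU.norm_le _ hzn _ habs _).trans (by gcongr; exact h n)
    _ ≤ M * (c * (r ^ t / r) * (M * ‖spaceDeriv Φ (t - n) (Φ n z) (derivSeq Φ z n v)‖)) := by
        gcongr
        exact hU.le_norm hzn habs _
    _ = M ^ 2 * c / r * r ^ t * ‖spaceDeriv Φ (t - n) (Φ n z) (derivSeq Φ z n v)‖ := by ring

variable [FiniteDimensional ℝ V]

theorem hasClosedGraph_fastSpace (hU : UniformlyPositive Φ C k K ε M) (hE : HasClosedGraph K E)
    (hEk : ∀ z ∈ K, Module.finrank ℝ (E z) = k)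
    (hD : ∀ z ∈ K, Dominates (derivSeq Φ z) (E z) M R r) :
    HasClosedGraph K fun z => fastSpace (derivSeq Φ z) r (E z) := by
  intro z z₀ hz hz₀ hlim f f₀ hf hflim
  have hR := (hD z₀ hz₀).const_nonneg
  have hr : 0 < 1 - r := by linarith [(hD z₀ hz₀).rate_lt_one]
  refine ⟨(1 + 2 * M ^ 2 * R / (1 - r)) * R * ‖f₀‖, by positivity, fun n v hv => ?_⟩
  obtain ⟨φ, hφ, p, hp, hpv⟩ := hE.exists_subseq_tendsto hEk hz hz₀ hlim hv
  have hzφ := hlim.comp hφ.tendsto_atTop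
  have hfφ := hflim.comp hφ.tendsto_atTop
  refine le_of_tendsto_of_tendsto'
    (hpv.norm.mul (tendsto_spaceDeriv_apply hU.contDiff n hzφ hfφ).norm)
    (((hfφ.norm.const_mul ((1 + 2 * M ^ 2 * R / (1 - r)) * R)).mul_const (r ^ n)).mul
      (tendsto_spaceDeriv_apply hU.contDiff n hzφ hpv).norm) fun j => ?_
  exact (hD _ (hz _)).norm_apply_le_of_mem_fastSpace (hf (φ j)) n (hp j)

theorem exists_separation (hU : UniformlyPositive Φ C k K ε M)
    (hD : ∀ z ∈ K, Dominates (derivSeq Φ z) (E z) M R r) (hR : 0 < R)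
    (hr0 : 0 < r) (hr1 : r < 1) :
    ∃ c γ : ℝ, 0 < c ∧ 0 < γ ∧ γ < 1 ∧
      ∀ z ∈ K, ∀ w ∈ fastSpace (derivSeq Φ z) r (E z), ‖w‖ = 1 → ∀ v ∈ E z, ‖v‖ = 1 →
        ∀ t : ℝ, 0 ≤ t → ‖spaceDeriv Φ t z w‖ ≤ c * γ ^ t * ‖spaceDeriv Φ t z v‖ := by
  have hM := hU.bound_pos
  have : 0 < 1 - r := by linarith
  refine ⟨M ^ 2 * ((1 + 2 * M ^ 2 * R / (1 - r)) * R) / r, r, by positivity, hr0, hr1, ?_⟩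
  intro z hz w hw hw1 v hv hv1 t ht
  refine hU.norm_spaceDeriv_le_of_norm_derivSeq_le hz (by positivity) hr0 hr1 (fun n => ?_) ht
  simpa [hv1, hw1] using (hD z hz).norm_apply_le_of_mem_fastSpace hw n hv

end UniformlyPositive

theorem exists_isExponentialSeparation [FiniteDimensional ℝ V] {Φ : Flow ℝ V} {C : Set V} {k : ℕ}
    (hC : IsKCone k C) (h : ContDiff ℝ 1 fun p : ℝ × V => Φ p.1 p.2)
    (hpos : ∀ x t, 0 < t → ∀ v ∈ C, v ≠ 0 → spaceDeriv Φ t x v ∈ interior C)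
    {K : Set V} (hK : IsCompact K) (hinv : ∀ z ∈ K, ∀ t, Φ t z ∈ K) :
    ∃ E F, IsExponentialSeparation Φ C k K E F := by
  obtain ⟨ε, M, hU⟩ := exists_uniformlyPositive hC h hpos hK hinv
  obtain ⟨R, r, hR, hr0, hr1, hdom⟩ := hU.exists_dominates
  choose E hEk hEC using hU.exists_submodule_subset_coneCore
  have hE : ∀ z, IsCoreSubspace Φ C k z (E z) := fun z => ⟨hEk z, hEC z⟩
  have hD : ∀ z ∈ K, Dominates (derivSeq Φ z) (E z) M R r := fun z hz => hdom z hz _ (hE z)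
  have hcore : ∀ z ∈ K, (E z : Set V) = coneCore Φ C z := fun z hz =>
    (hEC z).antisymm (hU.coneCore_subset_of_isCoreSubspace hdom hz (hE z))
  have hgraph := hU.hasClosedGraph_coneCore hcore
  have hmap : ∀ z ∈ K, ∀ t : ℝ, 0 < t →
      (E z).map (spaceDeriv Φ t z : V →ₗ[ℝ] V) = E (Φ t z) := fun z hz t ht => by
    have hEt := hU.isCoreSubspace_map (hE z) ht.le
    refine Submodule.eq_of_le_of_finrank_eq ?_ (by rw [hEt.finrank_eq, hEk])
    rw [← SetLike.coe_subset_coe, hcore _ (hinv z hz t)]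
    exact hEt.subset_coneCore
  refine ⟨E, fun z => fastSpace (derivSeq Φ z) r (E z), hgraph.isContinuousBundle fun z _ => hEk z,
    (hU.hasClosedGraph_fastSpace hgraph (fun z _ => hEk z) hD).isContinuousBundle fun z hz => ?_,
    fun z hz => (hD z hz).isCompl_fastSpace, hmap, fun z hz t ht => ?_,
    hU.exists_separation hD hR hr0 hr1, fun z _ v hv => ?_, fun z hz => ?_⟩
  · have := Submodule.finrank_add_eq_of_isCompl (hD z hz).isCompl_fastSpace
    rw [hEk] at this
    omega
  · rintro _ ⟨f, hf, rfl⟩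
    rw [← hmap z hz t ht]
    exact hU.spaceDeriv_mem_fastSpace (hD z hz).rate_pos.le hz hf t
  · refine or_iff_not_imp_right.2 fun hv0 => ?_
    have hback : spaceDeriv Φ (-1) z v ∈ C := by simpa using hEC z hv 1
    have := hpos (Φ (-1) z) 1 one_pos _ hback
      ((map_ne_zero_iff _ (spaceDeriv_injective h _ z)).2 hv0)
    rwa [spaceDeriv_apply_neg h] at this
  · refine Set.Subset.antisymm (fun f hf => ?_) ?_
    · exact hU.eq_zero_of_mem_fastSpace_of_mem_cone hz (hE z) (hD z hz) hf.1 hf.2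
    · rintro _ rfl
      exact ⟨Submodule.zero_mem _, hC.zero_mem⟩

section Expansion

variable {Φ : Flow ℝ V} {C : Set V} {k : ℕ} {K : Set V} {E F : V → Submodule ℝ V}

theorem IsExponentialSeparation.spaceDeriv_mem (hEF : IsExponentialSeparation Φ C k K E F)
    {z v : V} (hz : z ∈ K) (hv : v ∈ E z) {t : ℝ} (ht : 0 < t) : spaceDeriv Φ t z v ∈ E (Φ t z) :=
  hEF.map_E z hz t ht ▸ Submodule.mem_map_of_mem hv

theorem IsExponentialSeparation.exists_norm_mul_le
    (hEF : IsExponentialSeparation Φ C k K E F) :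
    ∃ M γ : ℝ, 0 < γ ∧ γ < 1 ∧ ∀ z ∈ K, ∀ f ∈ F z, ∀ e ∈ E z, ∀ t : ℝ, 0 ≤ t →
      ‖e‖ * ‖spaceDeriv Φ t z f‖ ≤ M * γ ^ t * ‖spaceDeriv Φ t z e‖ * ‖f‖ := by
  obtain ⟨M, γ, -, hγ0, hγ1, hsep⟩ := hEF.separation
  refine ⟨M, γ, hγ0, hγ1, fun z hz f hf e he t ht => ?_⟩
  rcases eq_or_ne f 0 with rfl | hf0
  · simp
  rcases eq_or_ne e 0 with rfl | he0
  · simp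
  obtain ⟨hf', hf1⟩ := normalize_mem_unitVectors hf hf0
  obtain ⟨he', he1⟩ := normalize_mem_unitVectors he he0
  have hle := hsep z hz _ hf' hf1 _ he' he1 t ht
  simp only [NormedSpace.normalize, map_smul, norm_smul, norm_inv, norm_norm] at hle
  have hf0' := norm_pos_iff.2 hf0
  have he0' := norm_pos_iff.2 he0
  field_simp at hle
  linarith

theorem IsExponentialSeparation.pow_mul_norm_le (h : ContDiff ℝ 1 fun p : ℝ × V => Φ p.1 p.2)
    (hinv : ∀ z ∈ K, ∀ t, Φ t z ∈ K) (hEF : IsExponentialSeparation Φ C k K E F) {τ b : ℝ}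
    (hτ : 0 < τ) (hb : 0 ≤ b) (hexp : ∀ z ∈ K, ∀ v ∈ E z, b * ‖v‖ ≤ ‖spaceDeriv Φ τ z v‖) (j : ℕ) :
    ∀ z ∈ K, ∀ v ∈ E z, b ^ j * ‖v‖ ≤ ‖spaceDeriv Φ (j * τ) z v‖ := by
  induction j with
  | zero => simp [spaceDeriv_zero_apply]
  | succ j ih =>
    intro z hz v hv
    calc b ^ (j + 1) * ‖v‖ = b ^ j * (b * ‖v‖) := by ring
      _ ≤ b ^ j * ‖spaceDeriv Φ τ z v‖ := by gcongr; exact hexp z hz v hv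
      _ ≤ ‖spaceDeriv Φ (j * τ) (Φ τ z) (spaceDeriv Φ τ z v)‖ :=
        ih _ (hinv z hz τ) _ (hEF.spaceDeriv_mem hz hv hτ)
      _ = ‖spaceDeriv Φ ((j + 1 : ℕ) * τ) z v‖ := by
        rw [← spaceDeriv_add_apply h, Nat.cast_succ, add_one_mul]

theorem exists_forall_norm_sub_sub_le (h : ContDiff ℝ 1 fun p : ℝ × V => Φ p.1 p.2)
    (hK : IsCompact K) (T : ℝ) {c : ℝ≥0} (hc : 0 < c) :
    ∃ δ > 0, ∀ z ∈ K, ∃ z' ∈ K, ∀ a ∈ Metric.ball z δ, ∀ b ∈ Metric.ball z δ,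
      ‖Φ T a - Φ T b - spaceDeriv Φ T z' (a - b)‖ ≤ c * ‖a - b‖ := by
  choose s hs hΦs using fun z =>
    (hasStrictFDerivAt_flow h T z).approximates_deriv_on_nhds (c := c) (Or.inr hc)
  obtain ⟨δ, hδ, hleb⟩ := lebesgue_number_lemma_of_metric (c := fun z : K => interior (s z)) hK
    (fun _ => isOpen_interior)
    fun z hz => Set.mem_iUnion.2 ⟨⟨z, hz⟩, mem_interior_iff_mem_nhds.2 (hs z)⟩
  refine ⟨δ, hδ, fun z hz => ?_⟩
  obtain ⟨⟨z', hz'⟩, hball⟩ := hleb z hz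
  exact ⟨z', hz', fun a ha b hb =>
    hΦs z' a (interior_subset (hball ha)) b (interior_subset (hball hb))⟩

theorem exists_expansion_nhds (h : ContDiff ℝ 1 fun p : ℝ × V => Φ p.1 p.2)
    (hK : IsCompact K) {T : ℝ} (hexp : ∀ z ∈ K, ∀ v ∈ C, 2 * ‖v‖ ≤ ‖spaceDeriv Φ T z v‖) :
    ∃ δ > 0, ∀ z ∈ K, ∀ a ∈ Metric.ball z δ, ∀ b ∈ Metric.ball z δ, Ordered C a b →
      3 / 2 * ‖a - b‖ ≤ ‖Φ T a - Φ T b‖ := by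
  obtain ⟨δ, hδ, hlin⟩ := exists_forall_norm_sub_sub_le h hK T (one_half_pos (α := ℝ≥0))
  refine ⟨δ, hδ, fun z hz a ha b hb hab => ?_⟩
  obtain ⟨z', hz', hz'lin⟩ := hlin z hz
  have hclose := hz'lin a ha b hb
  have hlarge := hexp z' hz' _ hab
  rw [norm_sub_rev] at hclose
  push_cast at hclose
  linarith [norm_sub_norm_le (spaceDeriv Φ T z' (a - b)) (Φ T a - Φ T b)]

theorem exists_lt_of_mul_le_add {g : ℝ → ℝ} {c T t₀ : ℝ} (hc : 1 < c) (hT : 0 ≤ T)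
    (hg₀ : 0 < g t₀) (hg : ∀ t ≥ t₀, c * g t ≤ g (T + t)) (B : ℝ) : ∃ t ≥ t₀, B < g t := by
  have hpow : ∀ j : ℕ, c ^ j * g t₀ ≤ g (j * T + t₀) := fun j => by
    induction j with
    | zero => simp
    | succ j ih =>
      calc c ^ (j + 1) * g t₀ = c * (c ^ j * g t₀) := by ring
        _ ≤ c * g (j * T + t₀) := by gcongr
        _ ≤ g (T + (j * T + t₀)) := hg _ (le_add_of_nonneg_left (by positivity))
        _ = g ((j + 1 : ℕ) * T + t₀) := by push_cast; ring_nf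
  obtain ⟨j, hj⟩ := pow_unbounded_of_one_lt (B / g t₀) hc
  exact ⟨j * T + t₀, le_add_of_nonneg_left (by positivity),
    ((div_lt_iff₀ hg₀).1 hj).trans_le (hpow j)⟩

theorem IsKCone.exists_ordered_near (hC : IsKCone k C) (x : V) {ρ : ℝ} (hρ : 0 < ρ) :
    ∃ y, Ordered C y x ∧ y ≠ x ∧ ‖y - x‖ < ρ := by
  obtain ⟨W, hWC, hWk⟩ := hC.isGreatest.1
  have hW0 : W ≠ ⊥ := by
    rintro rfl
    have := hC.one_le
    rw [finrank_bot] at hWk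
    omega
  obtain ⟨u, hu, hu1⟩ := unitVectors_nonempty hW0
  refine ⟨x + (ρ / 2) • u, ?_, ?_, ?_⟩
  · rw [Ordered, add_sub_cancel_left]
    exact hC.smul_mem u (hWC hu) _
  · rw [Ne, add_eq_left, smul_eq_zero, not_or]
    exact ⟨(half_pos hρ).ne', ne_zero_of_norm_ne_zero (hu1.trans_ne one_ne_zero)⟩
  · rw [add_sub_cancel_left, norm_smul, hu1, Real.norm_of_nonneg (half_pos hρ).le, mul_one]
    exact half_lt_self hρ

variable [FiniteDimensional ℝ V]

theorem IsExponentialSeparation.exists_norm_le_mul_norm (hC : IsKCone k C) (hK : IsCompact K)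
    (hEF : IsExponentialSeparation Φ C k K E F) :
    ∃ a : ℝ, ∀ z ∈ K, ∀ e ∈ E z, ∀ f ∈ F z, e + f ∈ C → ‖f‖ ≤ a * ‖e‖ := by
  by_contra! hcon
  choose z hz e _ f hf hef hlt using fun n : ℕ => hcon (n + 1)
  have hf0 : ∀ n, 0 < ‖f n‖ := fun n => (by positivity : (0 : ℝ) ≤ _).trans_lt (hlt n)
  obtain ⟨⟨z₀, u⟩, ⟨hz₀, hu⟩, φ, hφ, hlim⟩ := (hK.prod (isCompact_sphere (0 : V) 1)).tendsto_subseq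
    (x := fun n => (z n, ‖f n‖⁻¹ • f n)) fun n => ⟨hz n, mem_sphere_zero_iff_norm.2
      (normalize_mem_unitVectors (hf n) (norm_pos_iff.1 (hf0 n))).2⟩
  have hulim : Tendsto (fun n => ‖f (φ n)‖⁻¹ • f (φ n)) atTop (𝓝 u) :=
    (continuous_snd.tendsto _).comp hlim
  have helim : Tendsto (fun n => ‖f n‖⁻¹ • e n) atTop (𝓝 0) := by
    refine squeeze_zero_norm (fun n => ?_) tendsto_one_div_add_atTop_nhds_zero_nat
    rw [norm_smul, norm_inv, norm_norm, inv_mul_le_iff₀ (hf0 n), mul_one_div,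
      le_div_iff₀' (by positivity)]
    exact (hlt n).le
  have huF : u ∈ F z₀ := hEF.bundle_F.hasClosedGraph _ z₀ (fun n => hz (φ n)) hz₀
    ((continuous_fst.tendsto _).comp hlim) _ u (fun n => (F _).smul_mem _ (hf _)) hulim
  have huC : u ∈ C := by
    refine hC.isClosed.mem_of_tendsto (b := atTop)
      (by simpa using (helim.comp hφ.tendsto_atTop).add hulim) (Eventually.of_forall fun n => ?_)
    simpa using hC.smul_mem _ (hef (φ n)) ‖f (φ n)‖⁻¹
  have hu0 : u = 0 := (hEF.F_inter z₀ hz₀).subset ⟨huF, huC⟩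
  simp [hu0] at hu

theorem IsExponentialSeparation.eventually_norm_spaceDeriv_le_half (hC : IsKCone k C)
    (hK : IsCompact K) (hEF : IsExponentialSeparation Φ C k K E F) :
    ∀ᶠ t : ℝ in atTop, ∀ z ∈ K, ∀ e ∈ E z, ∀ f ∈ F z, e + f ∈ C →
      ‖spaceDeriv Φ t z f‖ ≤ 1 / 2 * ‖spaceDeriv Φ t z e‖ := by
  obtain ⟨a, ha⟩ := hEF.exists_norm_le_mul_norm hC hK
  obtain ⟨M, γ, hγ0, hγ1, hsep⟩ := hEF.exists_norm_mul_le
  have hlim : Tendsto (fun t : ℝ => |M| * a * γ ^ t) atTop (𝓝 0) := by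
    simpa using (tendsto_rpow_atTop_of_base_lt_one γ (by linarith) hγ1).const_mul (|M| * a)
  filter_upwards [hlim.eventually_le_const one_half_pos, eventually_ge_atTop 0]
    with t ht ht0 z hz e he f hf hef
  rcases eq_or_ne e 0 with rfl | he0
  · have hf0 : f = 0 := by simpa using ha z hz 0 he f hf hef
    simp [hf0]
  refine le_of_mul_le_mul_left ?_ (norm_pos_iff.2 he0)
  calc ‖e‖ * ‖spaceDeriv Φ t z f‖ ≤ M * γ ^ t * ‖spaceDeriv Φ t z e‖ * ‖f‖ :=
        hsep z hz f hf e he t ht0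
    _ ≤ |M| * γ ^ t * ‖spaceDeriv Φ t z e‖ * (a * ‖e‖) := by
        gcongr
        exacts [le_abs_self M, ha z hz e he f hf hef]
    _ = |M| * a * γ ^ t * (‖e‖ * ‖spaceDeriv Φ t z e‖) := by ring
    _ ≤ 1 / 2 * (‖e‖ * ‖spaceDeriv Φ t z e‖) := by gcongr
    _ = ‖e‖ * (1 / 2 * ‖spaceDeriv Φ t z e‖) := by ring

theorem IsExponentialSeparation.exists_expansion_cone
    (h : ContDiff ℝ 1 fun p : ℝ × V => Φ p.1 p.2) (hC : IsKCone k C) (hK : IsCompact K)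
    (hinv : ∀ z ∈ K, ∀ t, Φ t z ∈ K) (hEF : IsExponentialSeparation Φ C k K E F) {τ b : ℝ}
    (hτ : 0 < τ) (hb : 1 < b) (hexp : ∀ z ∈ K, ∀ v ∈ E z, b * ‖v‖ ≤ ‖spaceDeriv Φ τ z v‖) :
    ∃ T ≥ 0, ∀ z ∈ K, ∀ v ∈ C, 2 * ‖v‖ ≤ ‖spaceDeriv Φ T z v‖ := by
  obtain ⟨a, ha⟩ := hEF.exists_norm_le_mul_norm hC hK
  have htime : Tendsto (fun j : ℕ => (j : ℝ) * τ) atTop atTop :=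
    tendsto_natCast_atTop_atTop.atTop_mul_const hτ
  obtain ⟨j, hhalf, hbj⟩ := ((htime.eventually
    (hEF.eventually_norm_spaceDeriv_le_half hC hK)).and
    ((tendsto_pow_atTop_atTop_of_one_lt hb).eventually_ge_atTop (4 * (1 + a)))).exists
  refine ⟨j * τ, by positivity, fun z hz v hv => ?_⟩
  obtain ⟨e, f, he, hf, rfl⟩ := Submodule.codisjoint_iff_exists_add_eq.1
    (hEF.isCompl z hz).codisjoint v
  have hgrow : 4 * (1 + a) * ‖e‖ ≤ ‖spaceDeriv Φ (j * τ) z e‖ :=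
    (mul_le_mul_of_nonneg_right hbj (norm_nonneg e)).trans
      (hEF.pow_mul_norm_le h hinv hτ (by linarith) hexp j z hz e he)
  have hsplit : ‖e + f‖ ≤ (1 + a) * ‖e‖ := by
    linarith [norm_add_le e f, ha z hz e he f hf hv]
  have hlower := norm_sub_le_norm_add (spaceDeriv Φ (j * τ) z e) (spaceDeriv Φ (j * τ) z f)
  rw [← map_add] at hlower
  linarith [hhalf z hz e he f hf hv]

theorem mem_closure_pseudoOrdered_of_expansion (h : ContDiff ℝ 1 fun p : ℝ × V => Φ p.1 p.2)
    (hC : IsKCone k C) (hmono : StronglyMonotone Φ C) {x : V}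
    (hb : Bornology.IsBounded (Φ.forwardOrbit x)) {T : ℝ} (hT : 0 ≤ T)
    (hexp : ∀ z ∈ omega Φ x, ∀ v ∈ C, 2 * ‖v‖ ≤ ‖spaceDeriv Φ T z v‖) :
    x ∈ closure (pseudoOrdered Φ C) := by
  by_contra hx
  obtain ⟨δ, hδ, hδexp⟩ := exists_expansion_nhds h (isCompact_omega hb) hexp
  obtain ⟨ρ, hρ, hstable⟩ := hmono.exists_forall_norm_sub_lt hC.isClosed hb hx (half_pos hδ)
  obtain ⟨y, hyC, hyx, hyρ⟩ := hC.exists_ordered_near x hρ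
  have hnear := eventually_mem_of_omega_subset hb (Metric.isOpen_thickening (δ := δ / 2))
    (Metric.self_subset_thickening (half_pos hδ) _)
  obtain ⟨t₀, ht₀⟩ := eventually_atTop.1 (hnear.and (eventually_ge_atTop 0))
  have hgrow : ∀ t ≥ t₀, 3 / 2 * ‖Φ t y - Φ t x‖ ≤ ‖Φ (T + t) y - Φ (T + t) x‖ := by
    intro t ht
    obtain ⟨hmem, ht0⟩ := ht₀ t ht
    obtain ⟨z, hz, hzd⟩ := Metric.mem_thickening_iff.1 hmem
    have hclose : dist (Φ t y) (Φ t x) < δ / 2 := by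
      rw [dist_eq_norm]
      exact hstable y hyC hyρ t ht0
    rw [Φ.map_add, Φ.map_add]
    exact hδexp z hz _ (Metric.mem_ball.2 (by linarith [dist_triangle (Φ t y) (Φ t x) z])) _
      (Metric.mem_ball.2 (by linarith)) (hmono.monotone y x hyC t ht0)
  have hdiff : 0 < ‖Φ t₀ y - Φ t₀ x‖ :=
    norm_sub_pos_iff.2 ((Function.LeftInverse.injective (flow_neg_apply Φ t₀)).ne hyx)
  obtain ⟨t, ht, hlarge⟩ := exists_lt_of_mul_le_add (g := fun t => ‖Φ t y - Φ t x‖) (by norm_num)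
    hT hdiff hgrow (δ / 2)
  exact hlarge.not_gt (hstable y hyC hyρ t (ht₀ t ht).2)

end Expansion

section Cocycle

/-- `f` is a superadditive cocycle over `T` of at most linear growth. -/
structure IsSuperadditiveCocycle {X : Type*} (T : X → X) (f : ℕ → X → ℝ) (Λ : ℝ) : Prop where
  superadditive : ∀ m n x, f m x + f n (T^[m] x) ≤ f (m + n) x
  abs_apply_le : ∀ n x, |f n x| ≤ Λ * n

namespace IsSuperadditiveCocycle

variable {X : Type*} {T : X → X} {f : ℕ → X → ℝ} {Λ : ℝ}

theorem iInf_le (hf : IsSuperadditiveCocycle T f Λ) (n : ℕ) (x : X) : ⨅ y, f n y ≤ f n x :=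
  ciInf_le ⟨-(Λ * n), by rintro _ ⟨y, rfl⟩; exact (abs_le.1 (hf.abs_apply_le n y)).1⟩ x

theorem exists_tendsto_iInf [Nonempty X] (hf : IsSuperadditiveCocycle T f Λ) :
    ∃ β : ℝ, Tendsto (fun n : ℕ => (⨅ x, f n x) / n) atTop (𝓝 β) ∧
      ∀ n : ℕ, ⨅ x, f n x ≤ β * n := by
  have hsub : Subadditive fun n => -⨅ x, f n x := fun m n => by
    have : (⨅ x, f m x) + ⨅ x, f n x ≤ ⨅ x, f (m + n) x := le_ciInf fun x =>
      (add_le_add (hf.iInf_le m x) (hf.iInf_le n _)).trans (hf.superadditive m n x)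
    linarith
  obtain ⟨x₀⟩ := ‹Nonempty X›
  have hbdd : BddBelow (Set.range fun n : ℕ => (-⨅ x, f n x) / n) := by
    refine ⟨-Λ, ?_⟩
    rintro _ ⟨n, rfl⟩
    have hΛ : 0 ≤ Λ := by simpa using (abs_nonneg _).trans (hf.abs_apply_le 1 x₀)
    rcases n.eq_zero_or_pos with rfl | hn
    · simpa using hΛ
    refine (le_div_iff₀ (Nat.cast_pos.2 hn)).2 ?_
    linarith [hf.iInf_le n x₀, (abs_le.1 (hf.abs_apply_le n x₀)).2]
  refine ⟨-hsub.lim, (hsub.tendsto_lim hbdd).neg.congr fun n => by ring, fun n => ?_⟩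
  rcases n.eq_zero_or_pos with rfl | hn
  · simpa using (hf.iInf_le 0 x₀).trans (le_of_abs_le (hf.abs_apply_le 0 x₀))
  linarith [(le_div_iff₀ (Nat.cast_pos.2 hn)).1 (hsub.lim_le_div hbdd hn.ne')]

theorem exists_forall_le_mul (hf : IsSuperadditiveCocycle T f Λ) {β ε : ℝ} (hε : 0 < ε)
    (hslow : ∀ n : ℕ, ∃ x, f n x ≤ β * n + 1) (N : ℕ) : ∃ x, ∀ j ≤ N, f j x ≤ (β + ε) * j := by
  have hΛ : 0 ≤ Λ := by
    obtain ⟨x, -⟩ := hslow 0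
    simpa using (abs_nonneg _).trans (hf.abs_apply_le 1 x)
  obtain ⟨n, hn⟩ := exists_nat_gt (((Λ + |β| + ε) * N + 1) / ε)
  rw [div_lt_iff₀ hε] at hn
  obtain ⟨x, hx⟩ := hslow n
  -- From the time `s` at which the excess of the remaining growth over the rate `β + ε` is
  -- smallest, no initial stretch of the orbit can grow faster than at this rate.
  let excess : ℕ → ℝ := fun s => f (n - s) (T^[s] x) - (β + ε) * (n - s : ℕ)
  obtain ⟨s, hs, hmin⟩ := (Finset.range (n + 1)).exists_min_image excess ⟨0, by simp⟩
  have hsn : s ≤ n := Nat.lt_succ_iff.1 (Finset.mem_range.1 hs)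
  have hNs : N ≤ n - s := by
    by_contra! hlt
    have hfirst : excess s ≤ 1 - ε * n := by
      refine (hmin 0 (by simp)).trans ?_
      simp only [excess, Nat.sub_zero, Function.iterate_zero, id]
      linarith
    have hlast : -((Λ + |β| + ε) * (n - s : ℕ)) ≤ excess s := by
      have hβ : β * (n - s : ℕ) ≤ |β| * (n - s : ℕ) := by
        gcongr
        exact le_abs_self β
      simp only [excess]
      linarith [(abs_le.1 (hf.abs_apply_le (n - s) (T^[s] x))).1]
    have hshort : (Λ + |β| + ε) * (n - s : ℕ) ≤ (Λ + |β| + ε) * N := by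
      gcongr
    linarith
  refine ⟨T^[s] x, fun j hj => ?_⟩
  have hsplit : n - s = j + (n - (s + j)) := by omega
  have hexcess : excess s ≤ excess (s + j) := hmin (s + j) (Finset.mem_range.2 (by omega))
  have hadd := hf.superadditive j (n - (s + j)) (T^[s] x)
  rw [← Function.iterate_add_apply, ← hsplit, add_comm j s] at hadd
  have hcast : ((n - s : ℕ) : ℝ) = j + (n - (s + j) : ℕ) := mod_cast hsplit
  simp only [excess, hcast] at hexcess
  linarith

theorem exists_forall_le_of_lowerSemicontinuous [TopologicalSpace X] [CompactSpace X]
    (hf : IsSuperadditiveCocycle T f Λ) (hlsc : ∀ n, LowerSemicontinuous (f n)) {β : ℝ}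
    (hslow : ∀ n : ℕ, ∃ x, f n x ≤ β * n + 1) : ∃ x, ∀ j : ℕ, f j x ≤ β * j := by
  let A : ℕ → Set X := fun N => ⋂ j ≤ N, {x | f j x ≤ (β + 1 / ((N : ℝ) + 1)) * j}
  have hclosed : ∀ N, IsClosed (A N) := fun N =>
    isClosed_biInter fun j _ => (hlsc j).isClosed_preimage _
  have hnested : ∀ N, A (N + 1) ⊆ A N := fun N x hx => by
    simp only [A, Set.mem_iInter, Set.mem_ofPred_eq] at hx ⊢
    refine fun j hj => (hx j (hj.trans N.le_succ)).trans ?_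
    have : 1 / (((N + 1 : ℕ) : ℝ) + 1) ≤ 1 / ((N : ℝ) + 1) := by gcongr; simp
    gcongr
  obtain ⟨x, hx⟩ := IsCompact.nonempty_iInter_of_sequence_nonempty_isCompact_isClosed A hnested
    (fun N => by
      obtain ⟨x, hx⟩ := hf.exists_forall_le_mul (Nat.one_div_pos_of_nat (n := N)) hslow N
      exact ⟨x, Set.mem_iInter₂.2 hx⟩) (hclosed 0).isCompact hclosed
  refine ⟨x, fun j => ?_⟩
  have hlim : Tendsto (fun N : ℕ => (β + 1 / ((N : ℝ) + 1)) * j) atTop (𝓝 (β * j)) := by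
    simpa using (tendsto_one_div_add_atTop_nhds_zero_nat.const_add β).mul_const (j : ℝ)
  refine ge_of_tendsto hlim ?_
  filter_upwards [eventually_ge_atTop j] with N hN
  exact Set.mem_iInter₂.1 (Set.mem_iInter.1 hx N) j hN

theorem exists_tendsto_minimal [TopologicalSpace X] [CompactSpace X] [Nonempty X]
    (hf : IsSuperadditiveCocycle T f Λ) (hlsc : ∀ n, LowerSemicontinuous (f n)) :
    ∃ (β : ℝ) (x : X), Tendsto (fun n : ℕ => (⨅ y, f n y) / n) atTop (𝓝 β) ∧
      Tendsto (fun n : ℕ => f n x / n) atTop (𝓝 β) := by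
  obtain ⟨β, hβ, hle⟩ := hf.exists_tendsto_iInf
  obtain ⟨x, hx⟩ := hf.exists_forall_le_of_lowerSemicontinuous hlsc fun n =>
    (exists_lt_of_ciInf_lt ((hle n).trans_lt (lt_add_one _))).imp fun _ => le_of_lt
  refine ⟨β, x, hβ, tendsto_of_tendsto_of_tendsto_of_le_of_le' hβ tendsto_const_nhds ?_ ?_⟩
  · exact Eventually.of_forall fun n => div_le_div_of_nonneg_right (hf.iInf_le n x) n.cast_nonneg
  · filter_upwards [eventually_gt_atTop 0] with n hn
    exact (div_le_iff₀ (Nat.cast_pos.2 hn)).2 (hx n)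

end IsSuperadditiveCocycle

theorem tendsto_div_of_tendsto_natCast_div {g : ℝ → ℝ} {Λ β : ℝ}
    (hg : ∀ s t, |s - t| ≤ 1 → |g s - g t| ≤ Λ)
    (hlim : Tendsto (fun n : ℕ => g n / n) atTop (𝓝 β)) :
    Tendsto (fun t => g t / t) atTop (𝓝 β) := by
  have hfloor : Tendsto (fun t : ℝ => g ⌊t⌋₊ / ⌊t⌋₊ * (⌊t⌋₊ / t)) atTop (𝓝 β) := by
    simpa using (hlim.comp tendsto_nat_floor_atTop).mul (tendsto_nat_floor_div_atTop (R := ℝ))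
  have hrest : Tendsto (fun t : ℝ => (g t - g ⌊t⌋₊) / t) atTop (𝓝 0) := by
    refine squeeze_zero_norm' ?_ ((tendsto_const_nhds (x := Λ)).div_atTop tendsto_id)
    filter_upwards [eventually_gt_atTop 0] with t ht
    rw [norm_div, Real.norm_eq_abs, Real.norm_of_nonneg ht.le]
    refine div_le_div_of_nonneg_right (hg _ _ (abs_le.2 ⟨?_, ?_⟩)) ht.le <;>
      linarith [Nat.floor_le ht.le, Nat.lt_floor_add_one t]
  have hsum := hrest.add hfloor
  rw [zero_add] at hsum
  refine hsum.congr' ?_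
  filter_upwards [eventually_ge_atTop 1] with t ht
  have hfl : (0 : ℝ) < ⌊t⌋₊ := Nat.cast_pos.2 (Nat.floor_pos.2 ht)
  field_simp
  ring

end Cocycle

section Lyapunov

theorem infNorm_le_norm (A : V →L[ℝ] V) {L : Submodule ℝ V} {v : V} (hv : v ∈ unitVectors L) :
    infNorm A L ≤ ‖A v‖ :=
  csInf_le ⟨0, by rintro _ ⟨w, -, rfl⟩; exact norm_nonneg _⟩ ⟨v, hv, rfl⟩

theorem infNorm_mul_norm_le (A : V →L[ℝ] V) {L : Submodule ℝ V} {v : V} (hv : v ∈ L) :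
    infNorm A L * ‖v‖ ≤ ‖A v‖ := by
  rcases eq_or_ne v 0 with rfl | hv0
  · simp
  calc infNorm A L * ‖v‖ ≤ ‖A (NormedSpace.normalize v)‖ * ‖v‖ := by
        gcongr
        exact infNorm_le_norm A (normalize_mem_unitVectors hv hv0)
    _ = ‖A v‖ := by
        rw [mul_comm, ← norm_smul_of_nonneg (norm_nonneg v), ← map_smul,
          NormedSpace.norm_smul_normalize]

theorem exists_norm_eq_infNorm [FiniteDimensional ℝ V] (A : V →L[ℝ] V) {L : Submodule ℝ V}
    (hL : L ≠ ⊥) : ∃ v ∈ unitVectors L, ‖A v‖ = infNorm A L :=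
  ((isCompact_unitVectors L).image (f := fun v => ‖A v‖) (by fun_prop)).sInf_mem
    ((unitVectors_nonempty hL).image _)

/-- The logarithm `log m(D_zΦ_t|_{E_z})`, whose growth in `t` is measured by the `k`-Lyapunov
exponent. -/
noncomputable def logInfNorm (Φ : Flow ℝ V) (E : V → Submodule ℝ V) (t : ℝ) (z : V) : ℝ :=
  Real.log (infNorm (spaceDeriv Φ t z) (E z))

variable {Φ : Flow ℝ V} {C : Set V} {k : ℕ} {K : Set V} {E F : V → Submodule ℝ V}

theorem isRegular_of_tendsto {z : V} {β : ℝ}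
    (hlim : Tendsto (fun t => logInfNorm Φ E t z / t) atTop (𝓝 β)) :
    IsRegular Φ E z ∧ lyapunov Φ E z = β := by
  have hrate : Tendsto (growthRate Φ E z) atTop (𝓝 (β : EReal)) :=
    (continuous_coe_real_ereal.tendsto β).comp hlim
  have hlyap : lyapunov Φ E z = β := hrate.limsup_eq
  exact ⟨by rwa [IsRegular, hlyap], hlyap⟩

variable [FiniteDimensional ℝ V]

theorem exists_log_norm_eq_logInfNorm (Φ : Flow ℝ V) {z : V} (hE : E z ≠ ⊥) (t : ℝ) :
    ∃ v ∈ unitVectors (E z), Real.log ‖spaceDeriv Φ t z v‖ = logInfNorm Φ E t z := by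
  obtain ⟨v, hv, hmin⟩ := exists_norm_eq_infNorm (spaceDeriv Φ t z) hE
  exact ⟨v, hv, congrArg Real.log hmin⟩

theorem logInfNorm_zero {z : V} (hE : E z ≠ ⊥) : logInfNorm Φ E 0 z = 0 := by
  obtain ⟨v, hv, hmin⟩ := exists_log_norm_eq_logInfNorm Φ hE 0
  rw [← hmin, spaceDeriv_zero_apply, hv.2, Real.log_one]

section Smooth

variable (h : ContDiff ℝ 1 fun p : ℝ × V => Φ p.1 p.2)
include h

theorem infNorm_spaceDeriv_pos {L : Submodule ℝ V} (hL : L ≠ ⊥) (t : ℝ) (z : V) :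
    0 < infNorm (spaceDeriv Φ t z) L := by
  obtain ⟨v, hv, hmin⟩ := exists_norm_eq_infNorm (spaceDeriv Φ t z) hL
  rw [← hmin, norm_pos_iff, map_ne_zero_iff _ (spaceDeriv_injective h t z)]
  exact norm_ne_zero_iff.1 (hv.2.trans_ne one_ne_zero)

theorem logInfNorm_add_log_norm_le {z v : V} (hv : v ∈ E z) (hv0 : v ≠ 0) (t : ℝ) :
    logInfNorm Φ E t z + Real.log ‖v‖ ≤ Real.log ‖spaceDeriv Φ t z v‖ := by
  have hpos := infNorm_spaceDeriv_pos h (fun hbot : E z = ⊥ => hv0 (by simpa [hbot] using hv)) t z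
  rw [logInfNorm, ← Real.log_mul hpos.ne' (norm_ne_zero_iff.2 hv0)]
  exact Real.log_le_log (mul_pos hpos (norm_pos_iff.2 hv0)) (infNorm_mul_norm_le _ hv)

theorem logInfNorm_le_log_norm {z v : V} (hv : v ∈ unitVectors (E z)) (t : ℝ) :
    logInfNorm Φ E t z ≤ Real.log ‖spaceDeriv Φ t z v‖ := by
  simpa [hv.2] using
    logInfNorm_add_log_norm_le h hv.1 (norm_ne_zero_iff.1 (hv.2.trans_ne one_ne_zero)) t

theorem logInfNorm_add_logInfNorm_le {z : V} (hE : E z ≠ ⊥) {t : ℝ}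
    (hmap : ∀ v ∈ E z, spaceDeriv Φ t z v ∈ E (Φ t z)) (s : ℝ) :
    logInfNorm Φ E t z + logInfNorm Φ E s (Φ t z) ≤ logInfNorm Φ E (s + t) z := by
  obtain ⟨v, hv, hmin⟩ := exists_log_norm_eq_logInfNorm Φ hE (s + t)
  have hDv : spaceDeriv Φ t z v ≠ 0 := (map_ne_zero_iff _ (spaceDeriv_injective h t z)).2
    (norm_ne_zero_iff.1 (hv.2.trans_ne one_ne_zero))
  rw [← hmin, spaceDeriv_add_apply h]
  linarith [logInfNorm_le_log_norm h hv t, logInfNorm_add_log_norm_le h (hmap v hv.1) hDv s]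

theorem logInfNorm_add_le {z : V} (hE : E z ≠ ⊥) {M s t : ℝ} (hM0 : 0 < M)
    (hM : ∀ v, ‖spaceDeriv Φ s (Φ t z) v‖ ≤ M * ‖v‖) :
    logInfNorm Φ E (s + t) z ≤ Real.log M + logInfNorm Φ E t z := by
  obtain ⟨v, hv, hmin⟩ := exists_log_norm_eq_logInfNorm Φ hE t
  have hv0 : v ≠ 0 := norm_ne_zero_iff.1 (hv.2.trans_ne one_ne_zero)
  have hne : ∀ τ, 0 < ‖spaceDeriv Φ τ z v‖ := fun τ =>
    norm_pos_iff.2 ((map_ne_zero_iff _ (spaceDeriv_injective h τ z)).2 hv0)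
  calc logInfNorm Φ E (s + t) z ≤ Real.log ‖spaceDeriv Φ (s + t) z v‖ :=
        logInfNorm_le_log_norm h hv _
    _ ≤ Real.log (M * ‖spaceDeriv Φ t z v‖) :=
        Real.log_le_log (hne _) (spaceDeriv_add_apply h s t z v ▸ hM _)
    _ = Real.log M + logInfNorm Φ E t z := by rw [Real.log_mul hM0.ne' (hne t).ne', hmin]

theorem exists_abs_logInfNorm_sub_le (hK : IsCompact K) (hinv : ∀ z ∈ K, ∀ t, Φ t z ∈ K)
    (hE : ∀ z ∈ K, E z ≠ ⊥) :
    ∃ Λ, ∀ z ∈ K, ∀ s t, |s - t| ≤ 1 → |logInfNorm Φ E s z - logInfNorm Φ E t z| ≤ Λ := by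
  obtain ⟨M, hM1, hM⟩ := exists_norm_spaceDeriv_le h hK 1
  have hle : ∀ z ∈ K, ∀ s t, |s - t| ≤ 1 →
      logInfNorm Φ E s z ≤ Real.log M + logInfNorm Φ E t z := fun z hz s t hst => by
    simpa using logInfNorm_add_le h (hE z hz) (one_pos.trans_le hM1)
      (hM (Φ t z) (hinv z hz t) (s - t) hst)
  refine ⟨Real.log M, fun z hz s t hst => abs_sub_le_iff.2 ⟨?_, ?_⟩⟩
  · linarith [hle z hz s t hst]
  · linarith [hle z hz t s (abs_sub_comm s t ▸ hst)]

theorem HasClosedGraph.lowerSemicontinuous_logInfNorm (hG : HasClosedGraph K E)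
    (hE : ∀ z ∈ K, E z ≠ ⊥) (t : ℝ) :
    LowerSemicontinuous fun z : K => logInfNorm Φ E t z := by
  refine lowerSemicontinuous_iff_isClosed_preimage.2 fun c => IsSeqClosed.isClosed ?_
  intro z z₀ hz hlim
  choose v hv hmin using fun j => exists_norm_eq_infNorm (spaceDeriv Φ t (z j)) (hE _ (z j).2)
  obtain ⟨v₀, hv₀, φ, hφ, hvlim⟩ := (isCompact_sphere (0 : V) 1).tendsto_subseq
    (x := v) fun j => by simpa using (hv j).2
  have hzφ := (continuous_subtype_val.tendsto z₀).comp (hlim.comp hφ.tendsto_atTop)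
  have hv₀E : v₀ ∈ unitVectors (E z₀) :=
    ⟨hG _ z₀ (fun j => (z (φ j)).2) z₀.2 hzφ _ v₀ (fun j => (hv (φ j)).1) hvlim, by simpa using hv₀⟩
  refine (Real.log_le_iff_le_exp (infNorm_spaceDeriv_pos h (hE z₀ z₀.2) t z₀)).2 ?_
  refine (infNorm_le_norm _ hv₀E).trans
    (le_of_tendsto' (tendsto_spaceDeriv_apply h t hzφ hvlim).norm fun j => ?_)
  exact (hmin (φ j)).trans_le ((Real.log_le_iff_le_exp
    (infNorm_spaceDeriv_pos h (hE _ (z (φ j)).2) t _)).1 (hz (φ j)))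

end Smooth

theorem isSuperadditiveCocycle_logInfNorm (h : ContDiff ℝ 1 fun p : ℝ × V => Φ p.1 p.2)
    (hE : ∀ z ∈ K, E z ≠ ⊥) (hT : Set.MapsTo (Φ 1) K K)
    (hmap : ∀ z ∈ K, ∀ t, 0 < t → ∀ v ∈ E z, spaceDeriv Φ t z v ∈ E (Φ t z)) {Λ : ℝ}
    (hΛ : ∀ z ∈ K, ∀ s t, |s - t| ≤ 1 → |logInfNorm Φ E s z - logInfNorm Φ E t z| ≤ Λ) :
    IsSuperadditiveCocycle hT.restrict (fun n (z : K) => logInfNorm Φ E n z) Λ where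
  superadditive m n z := by
    rcases m.eq_zero_or_pos with rfl | hm
    · simp [logInfNorm_zero (hE z z.2)]
    have hadd := logInfNorm_add_logInfNorm_le h (hE z z.2)
      (hmap z z.2 m (Nat.cast_pos.2 hm)) (n : ℝ)
    rwa [hT.iterate_restrict, Set.MapsTo.val_restrict_apply, iterate_flow_one, Nat.cast_add,
      add_comm (m : ℝ)]
  abs_apply_le n z := by
    induction n with
    | zero => simp [logInfNorm_zero (hE z z.2)]
    | succ n ih =>
      have hstep := hΛ z z.2 (n + 1 : ℕ) n (by simp)
      calc |logInfNorm Φ E (n + 1 : ℕ) z|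
          ≤ |logInfNorm Φ E (n + 1 : ℕ) z - logInfNorm Φ E n z| + |logInfNorm Φ E n z| :=
            sub_le_iff_le_add.1 (abs_sub_abs_le_abs_sub _ _)
        _ ≤ Λ + Λ * n := add_le_add hstep ih
        _ = Λ * (n + 1 : ℕ) := by push_cast; ring

theorem IsExponentialSeparation.exists_expansion_of_lyapunov_pos
    (h : ContDiff ℝ 1 fun p : ℝ × V => Φ p.1 p.2) (hk : 1 ≤ k) (hK : IsCompact K)
    (hinv : ∀ z ∈ K, ∀ t, Φ t z ∈ K) (hEF : IsExponentialSeparation Φ C k K E F)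
    (hpos : ∀ z ∈ K, IsRegular Φ E z → 0 < lyapunov Φ E z) :
    ∃ n : ℕ, 0 < n ∧ ∀ z ∈ K, ∀ v ∈ E z, 2 * ‖v‖ ≤ ‖spaceDeriv Φ n z v‖ := by
  rcases K.eq_empty_or_nonempty with rfl | hne
  · exact ⟨1, one_pos, fun z hz => absurd hz (Set.notMem_empty z)⟩
  have : Nonempty K := hne.to_subtype
  have : CompactSpace K := isCompact_iff_compactSpace.1 hK
  have hE : ∀ z ∈ K, E z ≠ ⊥ := fun z hz hbot => by
    have hfin := hEF.bundle_E.finrank_eq z hz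
    rw [hbot, finrank_bot] at hfin
    omega
  obtain ⟨Λ, hΛ⟩ := exists_abs_logInfNorm_sub_le h hK hinv hE
  have hcocycle := isSuperadditiveCocycle_logInfNorm h hE (fun z hz => hinv z hz 1)
    (fun z hz t ht v hv => hEF.spaceDeriv_mem hz hv ht) hΛ
  obtain ⟨β, z, hβ, hz⟩ := hcocycle.exists_tendsto_minimal fun n =>
    hEF.bundle_E.hasClosedGraph.lowerSemicontinuous_logInfNorm h hE n
  obtain ⟨hreg, hlyap⟩ := isRegular_of_tendsto
    (tendsto_div_of_tendsto_natCast_div (hΛ z z.2) hz)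
  have hβ0 : 0 < β := EReal.coe_pos.1 (hlyap ▸ hpos z z.2 hreg)
  have hgrowth := hβ.pos_mul_atTop hβ0 tendsto_natCast_atTop_atTop
  obtain ⟨n, hn, hn0⟩ := ((hgrowth.eventually_ge_atTop (Real.log 2)).and
    (eventually_gt_atTop 0)).exists
  rw [div_mul_cancel₀ _ (Nat.cast_ne_zero.2 hn0.ne')] at hn
  refine ⟨n, hn0, fun y hy v hv => le_trans ?_ (infNorm_mul_norm_le _ hv)⟩
  gcongr
  exact (Real.log_le_log_iff two_pos (infNorm_spaceDeriv_pos h (hE y hy) n y)).1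
    (hn.trans (hcocycle.iInf_le n ⟨y, hy⟩))

end Lyapunov

end ConeFlow

theorem theorem4p6_general {V : Type*} [NormedAddCommGroup V] [NormedSpace ℝ V]
    [FiniteDimensional ℝ V] {Φ : Flow ℝ V} {C : Set V} {k : ℕ} (hC : IsKCone k C)
    (h : ContDiff ℝ 1 fun p : ℝ × V => Φ p.1 p.2) (hmono : StronglyMonotone Φ C)
    (hpos : ∀ x t, 0 < t → ∀ v ∈ C, v ≠ 0 → spaceDeriv Φ t x v ∈ interior C) {x : V}
    (hb : Bornology.IsBounded (Φ.forwardOrbit x)) :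
    (∃ E F : V → Submodule ℝ V, IsExponentialSeparation Φ C k (omega Φ x) E F) ∧
    ∀ E F : V → Submodule ℝ V, IsExponentialSeparation Φ C k (omega Φ x) E F →
      (∀ z ∈ regularOmega Φ E x, 0 < lyapunov Φ E z) → x ∈ closure (pseudoOrdered Φ C) := by
  have hK : IsCompact (omega Φ x) := isCompact_omega hb
  have hinv : ∀ z ∈ omega Φ x, ∀ t, Φ t z ∈ omega Φ x := fun z hz => apply_mem_omega hz
  refine ⟨exists_isExponentialSeparation hC h hpos hK hinv, fun E F hEF hreg => ?_⟩
  obtain ⟨n, hn, hexpE⟩ := hEF.exists_expansion_of_lyapunov_pos h hC.one_le hK hinv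
    fun z hz hzreg => hreg z ⟨hz, hzreg⟩
  obtain ⟨T, hT, hexpC⟩ := hEF.exists_expansion_cone h hC hK hinv (Nat.cast_pos.2 hn) one_lt_two
    hexpE
  exact mem_closure_pseudoOrdered_of_expansion h hC hmono hb hT hexpC

theorem theorem4p6 {V : Type*} [NormedAddCommGroup V] [NormedSpace ℝ V] [FiniteDimensional ℝ V]
    (Φ : Flow ℝ V) (C : Set V) (k : ℕ) (hΦ : FWW Φ C k)
    (D : Set V) (hD : IsOpen D) (hDω : OmegaCompact Φ D) (x : V) (hx : x ∈ D) :
    (∃ E F : V → Submodule ℝ V, IsExponentialSeparation Φ C k (omega Φ x) E F) ∧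
    ∀ E F : V → Submodule ℝ V, IsExponentialSeparation Φ C k (omega Φ x) E F →
      (∀ z ∈ regularOmega Φ E x, 0 < lyapunov Φ E z) →
      (∃ z ∈ omega Φ x \ regularOmega Φ E x, lyapunov Φ E z ≤ 0) →
      x ∈ closure (pseudoOrdered Φ C) :=
  let ⟨_, _, _, h⟩ := hΦ.smooth
  (theorem4p6_general hΦ.isKCone h.contDiff hΦ.stronglyMonotone hΦ.spaceDeriv_mem
    (hDω.1 x hx)).imp_right fun hsep E F hEF hreg _ => hsep E F hEF hreg
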